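/- Let $k$ be a field of characteristic $\neq 2$ containing an element $\sqrt{-1}$ with $(\sqrt{-1})^2=-1$, and let $n\ge 0$. **The Lie superalgebra.** Let $V$ be the superspace with even basis $v_1,\dots,v_n$ and odd basis $v_{\bar 1},\dots,v_{\bar n}$ (with $\bar{\bar i}=i$), put $I=\{1,\dots,n,\bar 1,\dots,\bar n\}$, and let $c:V\to V$ be the odd map $c(v_a)=(-1)^{|v_a|}\sqrt{-1}\,v_{\bar a}$. Let $\mathfrak q=\mathfrak q(V)=\{x\in\mathfrak{gl}(V): [x,c]=0\}$, where $[x,y]=xy-(-1)^{|x||y|}yx$. For $1\le i,j\le n$ set $e^{0}_{i,j}=e_{i,j}+e_{\bar i,\bar j}$, $e^{1}_{i,j}=e_{\bar i,j}+e_{i,\bar j}$ (a homogeneous basis of $\mathfrak q$) and $\tilde e^{0}_{i,j}=e_{i,j}-e_{\bar i,\bar j}$, $\tilde e^{1}_{i,j}=e_{\bar i,j}-e_{i,\bar j}$, where the $e_{a,b}$ are the matrix units. Let $U(\mathfrak q)$ be the universal enveloping superalgebra and $\sigma:U(\mathfrak q)\to U(\mathfrak q)$ its antipode: the linear map with $\sigma(1)=1$,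 $\sigma(x)=-x$ for $x\in\mathfrak q$ and $\sigma(uv)=(-1)^{|u||v|}\sigma(v)\sigma(u)$ for homogeneous $u,v$. **The diagrammatic side.** The degenerate affine oriented Brauer–Clifford supercategory $\mathcal{AOBC}$ is the strict monoidal $k$-linear supercategory generated by two objects $\uparrow,\downarrow$, even morphisms $\mathrm{cup}:\mathbf 1\to{\uparrow\downarrow}$, $\mathrm{cap}:{\downarrow\uparrow}\to\mathbf 1$, the crossing $s:{\uparrow\uparrow}\to{\uparrow\uparrow}$, the black dot $x:{\uparrow}\to{\uparrow}$, a two-sided inverse $s':{\uparrow\downarrow}\to{\downarrow\uparrow}$ of the rotated crossing $(\mathrm{cap}\otimes 1_{\uparrow\downarrow})(1_\downarrow\otimes s\otimes 1_\downarrow)(1_{\downarrow\uparrow}\otimes\mathrm{cup})$, and one odd morphism, the white dot $\circ:{\uparrow}\to{\uparrow}$, subject to the relations $$s^2=1,\qquad (s\otimes 1_\uparrow)(1_\uparrow\otimes s)(s\otimes 1_\uparrow)=(1_\uparrow\otimes s)(s\otimes 1_\uparrow)(1_\uparrow\otimes s),$$ $$(1_\uparrow\otimes\mathrm{cap})(\mathrm{cup}\otimes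 1_\uparrow)=1_\uparrow,\qquad (\mathrm{cap}\otimes 1_\downarrow)(1_\downarrow\otimes\mathrm{cup})=1_\downarrow,$$ $$\circ^2=1,\qquad s(\circ\otimes 1)=(1\otimes\circ)s,\qquad \mathrm{cap}\,(1_\downarrow\otimes\circ)\,s'\,\mathrm{cup}=0,$$ $$x\circ=-\circ x,\qquad (x\otimes 1)s-s(1\otimes x)=1-(\circ\otimes 1)(1\otimes\circ).$$ There is a monoidal superfunctor $\Psi$ from $\mathcal{AOBC}$ to the superfunctors and supernatural transformations from the category of $U(\mathfrak q)$-supermodules to itself. It sends $\uparrow$ and $\downarrow$ to $V\otimes-$ and $V^*\otimes-$, and on generators it is given, for each supermodule $M$, by $$\mathrm{cup}: m\mapsto\sum_{a\in I}v_a\otimes v_a^*\otimes m,\qquad \mathrm{cap}: f\otimes v\otimes m\mapsto f(v)m,\qquad s: u\otimes v\otimes m\mapsto(-1)^{|u||v|}v\otimes u\otimes m,$$ $$s': u\otimes f\otimes m\mapsto(-1)^{|u||f|}f\otimes u\otimes m,\qquad \circ: v\otimes m\mapsto c(v)\otimes m,$$ $$x: v\otimes m\mapsto\Omega(v\otimes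 m)=\sum_{\varepsilon\in\mathbb Z/2}\ \sum_{1\le i,j\le n}(-1)^{\varepsilon|v|}\,\tilde e^{\varepsilon}_{i,j}v\otimes e^{\varepsilon}_{j,i}m .$$ For $m\ge 0$ let $\Delta_m=\mathrm{cap}\,(1_\downarrow\otimes x^m)\,s'\,\mathrm{cup}\in\mathrm{End}_{\mathcal{AOBC}}(\mathbf 1)$ be the counterclockwise bubble carrying $m$ black dots on its upward strand, and put $$z_m=\Psi(\Delta_m)_{U(\mathfrak q)}(1)\in U(\mathfrak q).$$ **Sergeev's elements.** Define $x^{\varepsilon}_{i,j}(m)\in U(\mathfrak q)$, for $1\le i,j\le n$, $\varepsilon\in\mathbb Z/2$ and $m\ge 0$, by $x^0_{i,j}(0)=\delta_{i,j}$, $x^1_{i,j}(0)=0$ and, for $m\ge1$, $$x^{0}_{i,j}(m)=\sum_{r=1}^n\Bigl(e^{0}_{i,r}\,x^{0}_{r,j}(m-1)+(-1)^{m-1}e^{1}_{i,r}\,x^{1}_{r,j}(m-1)\Bigr),$$ $$x^{1}_{i,j}(m)=\sum_{r=1}^n\Bigl(e^{0}_{i,r}\,x^{1}_{r,j}(m-1)+(-1)^{m-1}e^{1}_{i,r}\,x^{0}_{r,j}(m-1)\Bigr),$$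 and for $t\ge1$ put $S_t=\sum_{i=1}^n x^0_{i,i}(2t-1)$. **Proposition.** For every integer $t\ge1$, $$z_{2t-1}=-2\,\sigma(S_t)\quad\text{in } U(\mathfrak q).$$ -/

import Mathlib

open scoped TensorProduct

noncomputable section

namespace TypeQ

universe u

/-- The sign `(-1)^a` of a parity `a ∈ ℤ/2`. -/
def sg (k : Type u) [Field k] (a : ZMod 2) : k := if a = 0 then 1 else -1

/-- The index set `I = {1, …, n, 1̄, …, n̄}`: `(i, 0)` is `i` and `(i, 1)` is `ī`.
The second component is the parity of the basis vector. -/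
abbrev Idx (n : ℕ) : Type := Fin n × ZMod 2

/-- The superspace `V` with basis `v_a`, `a ∈ I`. -/
abbrev V (k : Type u) [Field k] (n : ℕ) : Type u := Idx n → k

section Signs

variable {k : Type u} [Field k]

theorem zcases (a : ZMod 2) : a = 0 ∨ a = 1 := by
  revert a; decide

@[simp] theorem sg_zero : sg k 0 = 1 := by simp [sg]

@[simp] theorem sg_one : sg k 1 = -1 := by simp [sg]

theorem zadd_self (a : ZMod 2) : a + a = 0 := by
  revert a; decide

theorem sg_add (a b : ZMod 2) : sg k (a + b) = sg k a * sg k b := by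
  rcases zcases a with rfl | rfl <;> rcases zcases b with rfl | rfl <;> simp [zadd_self]

@[simp] theorem sg_sq (a : ZMod 2) : sg k a * sg k a = 1 := by
  rcases zcases a with rfl | rfl <;> simp

end Signs

section LieSuperalgebra

variable {k : Type u} [Field k] {n : ℕ}

/-- The homogeneous part `gl(V)_ε` of `gl(V)`. -/
def gl (k : Type u) [Field k] (n : ℕ) (ε : ZMod 2) : Submodule k (Matrix (Idx n) (Idx n) k) where
  carrier := {x | ∀ a b : Idx n, a.2 + b.2 ≠ ε → x a b = 0}
  add_mem' := by
    intro x y hx hy a b h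
    simp [hx a b h, hy a b h]
  zero_mem' := by
    intro a b _
    rfl
  smul_mem' := by
    intro r x hx a b h
    simp [hx a b h]

/-- The graded commutator `[x, y] = xy - (-1)^{|x||y|} yx` of `x ∈ gl(V)_ε`, `y ∈ gl(V)_δ`. -/
def sbr (ε δ : ZMod 2) (x y : Matrix (Idx n) (Idx n) k) : Matrix (Idx n) (Idx n) k :=
  x * y - sg k (ε * δ) • (y * x)

/-- The odd linear map `c : V → V`, `c(v_a) = (-1)^{|v_a|} √-1 v_{ā}`; here `s = √-1`. -/
def cMat (s : k) : Matrix (Idx n) (Idx n) k :=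
  fun a b => if a = (b.1, b.2 + 1) then sg k b.2 * s else 0

/-- The homogeneous part `q(V)_ε = {x ∈ gl(V)_ε | [x, c] = 0}` of the Lie superalgebra `q(V)`. -/
def q (s : k) (n : ℕ) (ε : ZMod 2) : Submodule k (Matrix (Idx n) (Idx n) k) where
  carrier := {x | x ∈ gl k n ε ∧ sbr ε 1 x (cMat s) = 0}
  add_mem' := by
    rintro x y ⟨hx, hx'⟩ ⟨hy, hy'⟩
    refine ⟨add_mem hx hy, ?_⟩
    have : sbr ε 1 (x + y) (cMat s) = sbr ε 1 x (cMat s) + sbr ε 1 y (cMat s) := by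
      simp only [sbr, add_mul, mul_add, smul_add]
      abel
    rw [this, hx', hy', add_zero]
  zero_mem' := ⟨zero_mem _, by simp [sbr]⟩
  smul_mem' := by
    rintro r x ⟨hx, hx'⟩
    refine ⟨(gl k n ε).smul_mem r hx, ?_⟩
    have : sbr ε 1 (r • x) (cMat s) = r • sbr ε 1 x (cMat s) := by
      simp only [sbr, smul_mul_assoc, mul_smul_comm, smul_sub, smul_comm r]
    rw [this, hx', smul_zero]

theorem mul_mem_gl {ε δ : ZMod 2} {x y : Matrix (Idx n) (Idx n) k} (hx : x ∈ gl k n ε)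
    (hy : y ∈ gl k n δ) : x * y ∈ gl k n (ε + δ) := by
  intro a b h
  rw [Matrix.mul_apply]
  refine Finset.sum_eq_zero fun d _ => ?_
  by_cases h1 : a.2 + d.2 = ε
  · by_cases h2 : d.2 + b.2 = δ
    · exfalso
      apply h
      rw [← h1, ← h2]
      linear_combination (-1 : ZMod 2) * zadd_self d.2
    · rw [hy d b h2, mul_zero]
  · rw [hx a d h1, zero_mul]

theorem sbr_mem_q {s : k} {ε δ : ZMod 2} {x y : Matrix (Idx n) (Idx n) k} (hx : x ∈ q s n ε)
    (hy : y ∈ q s n δ) : sbr ε δ x y ∈ q s n (ε + δ) := by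
  obtain ⟨hx, hx'⟩ := hx
  obtain ⟨hy, hy'⟩ := hy
  refine ⟨sub_mem (mul_mem_gl hx hy)
    ((gl k n (ε + δ)).smul_mem _ (add_comm δ ε ▸ mul_mem_gl hy hx)), ?_⟩
  simp only [sbr, mul_one] at hx' hy' ⊢
  have e1 : x * cMat s = sg k ε • (cMat s * x) := sub_eq_zero.mp hx'
  have e2 : y * cMat s = sg k δ • (cMat s * y) := sub_eq_zero.mp hy'
  rw [sub_eq_zero, sub_mul, mul_assoc, e2, smul_mul_assoc, mul_assoc, e1]
  simp only [mul_smul_comm, ← mul_assoc, e1, e2, sg_add, smul_mul_assoc, mul_sub, smul_sub,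
    smul_smul]
  congr 2 <;> ring

/-- The Lie superbracket `q(V)_ε × q(V)_δ → q(V)_{ε+δ}`. -/
def br {s : k} {ε δ : ZMod 2} (x : q s n ε) (y : q s n δ) : q s n (ε + δ) :=
  ⟨sbr ε δ x.1 y.1, sbr_mem_q x.2 y.2⟩

/-- The matrix `e_{i,j}^ε`: `e_{i,j}^0 = e_{i,j} + e_{ī,j̄}` and `e_{i,j}^1 = e_{ī,j} + e_{i,j̄}`. -/
def eMat (ε : ZMod 2) (i j : Fin n) : Matrix (Idx n) (Idx n) k :=
  Matrix.single (i, ε) (j, 0) 1 + Matrix.single (i, 1 + ε) (j, 1) 1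

/-- The matrix `ẽ_{i,j}^ε`: `ẽ_{i,j}^0 = e_{i,j} - e_{ī,j̄}` and `ẽ_{i,j}^1 = e_{ī,j} - e_{i,j̄}`. -/
def etMat (ε : ZMod 2) (i j : Fin n) : Matrix (Idx n) (Idx n) k :=
  Matrix.single (i, ε) (j, 0) 1 - Matrix.single (i, 1 + ε) (j, 1) 1

theorem eMat_apply (ε : ZMod 2) (i j : Fin n) (a b : Idx n) :
    eMat (k := k) ε i j a b = if a = (i, b.2 + ε) ∧ b.1 = j then 1 else 0 := by
  obtain ⟨a1, a2⟩ := a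
  obtain ⟨b1, b2⟩ := b
  rcases zcases b2 with rfl | rfl <;>
    simp [eMat, Matrix.single_apply, Prod.ext_iff, eq_comm, and_assoc]

theorem etMat_apply (ε : ZMod 2) (i j : Fin n) (a b : Idx n) :
    etMat (k := k) ε i j a b = if a = (i, b.2 + ε) ∧ b.1 = j then sg k b.2 else 0 := by
  obtain ⟨a1, a2⟩ := a
  obtain ⟨b1, b2⟩ := b
  rcases zcases b2 with rfl | rfl <;>
    simp [etMat, Matrix.single_apply, Prod.ext_iff, eq_comm, and_assoc, apply_ite]

theorem eMat_mem (s : k) (ε : ZMod 2) (i j : Fin n) : eMat ε i j ∈ q s n ε := by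
  constructor
  · intro a b h
    rw [eMat_apply, if_neg]
    rintro ⟨h1, -⟩
    apply h
    rw [h1]
    linear_combination zadd_self b.2
  · rw [sbr, sub_eq_zero]
    ext ⟨a1, a2⟩ ⟨b1, b2⟩
    simp only [Matrix.mul_apply, Matrix.smul_apply, eMat_apply, cMat, mul_one, smul_eq_mul]
    rw [Finset.sum_eq_single (b1, b2 + 1), Finset.sum_eq_single (i, b2 + ε)]
    · rcases zcases b2 with rfl | rfl <;> rcases zcases ε with rfl | rfl <;>
        simp [Prod.ext_iff, zadd_self] <;> split_ifs <;> simp_all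
    · intro d _ hd
      rw [if_neg (c := d = (i, b2 + ε) ∧ b1 = j) (fun h => hd h.1)]; simp
    · simp
    · intro d _ hd
      rw [if_neg (c := d = (b1, b2 + 1)) hd]; simp
    · simp

/-- The basis element `e_{i,j}^ε` of `q(V)_ε`. -/
def e (s : k) (ε : ZMod 2) (i j : Fin n) : q s n ε := ⟨eMat ε i j, eMat_mem s ε i j⟩

end LieSuperalgebra

section Enveloping

variable {k : Type u} [Field k]

/-- The generators of `U(q)`: the homogeneous elements of `q(V)`. -/
abbrev UGen (s : k) (n : ℕ) : Type u := Σ ε : ZMod 2, q s n ε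

/-- The relations of the universal enveloping superalgebra: the inclusion of `q(V)` is linear,
and `xy - (-1)^{|x||y|} yx = [x, y]`. -/
inductive URel (s : k) (n : ℕ) :
    FreeAlgebra k (UGen s n) → FreeAlgebra k (UGen s n) → Prop
  | add (ε : ZMod 2) (x y : q s n ε) :
      URel s n (FreeAlgebra.ι k ⟨ε, x + y⟩) (FreeAlgebra.ι k ⟨ε, x⟩ + FreeAlgebra.ι k ⟨ε, y⟩)
  | smul (ε : ZMod 2) (r : k) (x : q s n ε) :
      URel s n (FreeAlgebra.ι k ⟨ε, r • x⟩) (r • FreeAlgebra.ι k ⟨ε, x⟩)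
  | bracket (ε δ : ZMod 2) (x : q s n ε) (y : q s n δ) :
      URel s n
        (FreeAlgebra.ι k ⟨ε, x⟩ * FreeAlgebra.ι k ⟨δ, y⟩
          - sg k (ε * δ) • (FreeAlgebra.ι k ⟨δ, y⟩ * FreeAlgebra.ι k ⟨ε, x⟩))
        (FreeAlgebra.ι k ⟨ε + δ, br x y⟩)

/-- The universal enveloping superalgebra `U(q)`. -/
def U (s : k) (n : ℕ) : Type u := RingQuot (URel s n)

instance (s : k) (n : ℕ) : Ring (U s n) := inferInstanceAs (Ring (RingQuot (URel s n)))

instance (s : k) (n : ℕ) : Algebra k (U s n) :=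
  inferInstanceAs (Algebra k (RingQuot (URel s n)))

variable {s : k} {n : ℕ}

/-- The inclusion of `q(V)_ε` in `U(q)`. -/
def ι (ε : ZMod 2) : q s n ε →ₗ[k] U s n where
  toFun x := RingQuot.mkAlgHom k (URel s n) (FreeAlgebra.ι k ⟨ε, x⟩)
  map_add' x y := by
    rw [RingQuot.mkAlgHom_rel k (URel.add ε x y), map_add]
    rfl
  map_smul' r x := by
    rw [RingQuot.mkAlgHom_rel k (URel.smul ε r x), map_smul]
    rfl

theorem ι_br {ε δ : ZMod 2} (x : q s n ε) (y : q s n δ) :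
    ι (ε + δ) (br x y) = ι ε x * ι δ y - sg k (ε * δ) • (ι δ y * ι ε x) := by
  have h := RingQuot.mkAlgHom_rel k (URel.bracket ε δ x y)
  rw [map_sub, map_smul, map_mul, map_mul] at h
  exact h.symm

/-- The universal property of `U(q)`. -/
def ULift {A : Type u} [Ring A] [Algebra k A] (f : ∀ ε : ZMod 2, q s n ε →ₗ[k] A)
    (hf : ∀ (ε δ : ZMod 2) (x : q s n ε) (y : q s n δ),
      f ε x * f δ y - sg k (ε * δ) • (f δ y * f ε x) = f (ε + δ) (br x y)) :
    U s n →ₐ[k] A :=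
  RingQuot.liftAlgHom k ⟨FreeAlgebra.lift k (fun x : UGen s n => f x.1 x.2), by
    intro x y h
    cases h with
    | add => simp
    | smul => simp
    | bracket ε δ x y => simpa using hf ε δ x y⟩

@[simp] theorem ULift_ι {A : Type u} [Ring A] [Algebra k A] (f : ∀ ε : ZMod 2, q s n ε →ₗ[k] A)
    (hf) (ε : ZMod 2) (x : q s n ε) : ULift f hf (ι ε x) = f ε x := by
  change RingQuot.liftAlgHom k _ (RingQuot.mkAlgHom k (URel s n) _) = _
  rw [RingQuot.liftAlgHom_mkAlgHom_apply]
  simp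

theorem U_induction {P : U s n → Prop} (h0 : ∀ r : k, P (algebraMap k _ r))
    (hι : ∀ ε (x : q s n ε), P (ι ε x)) (hmul : ∀ a b, P a → P b → P (a * b))
    (hadd : ∀ a b, P a → P b → P (a + b)) (a : U s n) : P a := by
  obtain ⟨a, rfl⟩ := RingQuot.mkAlgHom_surjective k (URel s n) a
  induction a using FreeAlgebra.induction with
  | grade0 r => rw [AlgHom.commutes]; exact h0 r
  | grade1 x => exact hι x.1 x.2
  | mul a b ha hb => rw [map_mul]; exact hmul _ _ ha hb
  | add a b ha hb => rw [map_add]; exact hadd _ _ ha hb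

/-- The parity automorphism of `U(q)`: it is `(-1)^{|u|}` on homogeneous `u`. -/
def parU (s : k) (n : ℕ) : U s n →ₐ[k] U s n :=
  ULift (fun ε => sg k ε • ι ε) (by
    intro ε δ x y
    simp only [LinearMap.smul_apply, ι_br, smul_mul_assoc, mul_smul_comm, sg_add, smul_sub,
      smul_smul]
    congr 2 <;> ring)

@[simp] theorem parU_ι (ε : ZMod 2) (x : q s n ε) : parU s n (ι ε x) = sg k ε • ι ε x := by
  simp [parU]

@[simp] theorem parU_parU (a : U s n) : parU s n (parU s n a) = a := by
  induction a using U_induction with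
  | h0 r => simp
  | hι ε x => simp [smul_smul]
  | hmul a b ha hb => simp [ha, hb]
  | hadd a b ha hb => simp [ha, hb]

/-- The map `u ↦ (-1)^{ε|u|} u` of `U(q)`. -/
def parUPow (s : k) (n : ℕ) (ε : ZMod 2) : U s n →ₐ[k] U s n :=
  if ε = 0 then AlgHom.id k _ else parU s n

theorem parUPow_add (ε δ : ZMod 2) (a : U s n) :
    parUPow s n (ε + δ) a = parUPow s n ε (parUPow s n δ a) := by
  rcases zcases ε with rfl | rfl <;> rcases zcases δ with rfl | rfl <;>
    simp [parUPow, zadd_self]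

@[simp] theorem parUPow_ι (ε δ : ZMod 2) (x : q s n δ) :
    parUPow s n ε (ι δ x) = sg k (ε * δ) • ι δ x := by
  rcases zcases ε with rfl | rfl <;> simp [parUPow]

/-- The `q(V)`-action on `U(q)` given by `x · u = -(-1)^{|x||u|} u x`. -/
def rAct (s : k) (n : ℕ) : U s n →ₐ[k] Module.End k (U s n) :=
  ULift (fun ε =>
    { toFun := fun x => -(LinearMap.mulRight k (ι ε x) ∘ₗ (parUPow s n ε).toLinearMap)
      map_add' := by
        intro x y
        ext u
        simp [mul_add, add_comm]
      map_smul' := by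
        intro r x
        ext u
        simp }) (by
    intro ε δ x y
    ext u
    simp only [LinearMap.coe_mk, AddHom.coe_mk, ι_br, LinearMap.sub_apply, Module.End.mul_apply,
      LinearMap.neg_apply, LinearMap.comp_apply, LinearMap.mulRight_apply, LinearMap.smul_apply,
      AlgHom.toLinearMap_apply, map_neg, map_mul, parUPow_ι, neg_neg, parUPow_add,
      mul_sub, mul_smul_comm, smul_mul_assoc, smul_smul, ← mul_assoc, mul_comm δ ε]
    rw [← parUPow_add ε δ, ← parUPow_add δ ε, add_comm δ ε, sg_sq, one_smul]
    abel)

/-- The antipode `σ` of `U(q)`; see `antipode_one`, `antipode_ι` and `antipode_mul`. -/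
def antipode (s : k) (n : ℕ) : U s n →ₗ[k] U s n :=
  (LinearMap.applyₗ (1 : U s n)) ∘ₗ (rAct s n).toLinearMap

theorem antipode_one : antipode s n 1 = 1 := by
  simp [antipode]

theorem antipode_ι (ε : ZMod 2) (x : q s n ε) : antipode s n (ι ε x) = -ι ε x := by
  simp [antipode, rAct]

theorem antipode_ι_mul (ε : ZMod 2) (x : q s n ε) (u : U s n) :
    antipode s n (ι ε x * u) = -(parUPow s n ε (antipode s n u) * ι ε x) := by
  simp [antipode, rAct]

/-- `σ` is a superalgebra anti-homomorphism: `σ(uv) = (-1)^{|u||v|} σ(v) σ(u)`. -/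
theorem antipode_mul (h2 : (2 : k) ≠ 0) (ε : ZMod 2) (u v : U s n)
    (hu : parU s n u = sg k ε • u) :
    antipode s n (u * v) = parUPow s n ε (antipode s n v) * antipode s n u := by
  let Q : ZMod 2 → U s n → Prop := fun ε u => parU s n u = sg k ε • u ∧
    ∀ v, antipode s n (u * v) = parUPow s n ε (antipode s n v) * antipode s n u
  have hQadd : ∀ ε a b, Q ε a → Q ε b → Q ε (a + b) := by
    rintro ε a b ⟨ha, ha'⟩ ⟨hb, hb'⟩
    exact ⟨by simp [ha, hb], fun v => by simp [add_mul, mul_add, ha', hb']⟩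
  have hQmul : ∀ ε δ a b, Q ε a → Q δ b → Q (ε + δ) (a * b) := by
    rintro ε δ a b ⟨ha, ha'⟩ ⟨hb, hb'⟩
    refine ⟨by simp [ha, hb, sg_add, smul_smul, mul_comm], fun v => ?_⟩
    rw [mul_assoc, ha', hb', ha', parUPow_add, map_mul, mul_assoc]
  have hQ0 : ∀ ε, Q ε 0 := fun ε => ⟨by simp, fun v => by simp⟩
  have key : ∃ f : ZMod 2 → U s n, u = f 0 + f 1 ∧ ∀ ε, Q ε (f ε) := by
    clear hu
    induction u using U_induction with
    | h0 r =>
      refine ⟨fun ε => if ε = 0 then algebraMap k _ r else 0, by simp, fun ε => ?_⟩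
      rcases zcases ε with rfl | rfl
      · refine ⟨by simp, fun v => ?_⟩
        simp [Algebra.algebraMap_eq_smul_one, antipode_one, parUPow]
      · simpa using hQ0 1
    | hι δ x =>
      refine ⟨fun ε => if ε = δ then ι δ x else 0, ?_, fun ε => ?_⟩
      · rcases zcases δ with rfl | rfl <;> simp
      · by_cases h : ε = δ
        · subst h
          simp only [if_true]
          exact ⟨by simp, fun v => by rw [antipode_ι_mul, antipode_ι, mul_neg]⟩
        · simpa [h] using hQ0 ε
    | hmul a b ha hb =>
      obtain ⟨f, rfl, hf⟩ := ha
      obtain ⟨g, rfl, hg⟩ := hb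
      refine ⟨fun ε => f ε * g 0 + f (ε + 1) * g 1, ?_, fun ε => ?_⟩
      · simp only [zadd_self, zero_add]
        noncomm_ring
      · refine hQadd _ _ _ ?_ ?_
        · simpa using hQmul ε 0 _ _ (hf ε) (hg 0)
        · simpa [add_assoc, zadd_self] using hQmul (ε + 1) 1 _ _ (hf _) (hg 1)
    | hadd a b ha hb =>
      obtain ⟨f, rfl, hf⟩ := ha
      obtain ⟨g, rfl, hg⟩ := hb
      exact ⟨fun ε => f ε + g ε, by dsimp only; abel, fun ε => hQadd _ _ _ (hf ε) (hg ε)⟩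
  obtain ⟨f, rfl, hf⟩ := key
  have hz : f (ε + 1) = 0 := by
    rw [map_add, (hf 0).1, (hf 1).1] at hu
    have : (2 : k) • f (ε + 1) = 0 := by
      rcases zcases ε with rfl | rfl
      · simp only [sg_zero, sg_one, one_smul, neg_smul] at hu
        rw [zero_add, two_smul]
        calc f 1 + f 1 = (f 0 + f 1) - (f 0 + -f 1) := by abel
          _ = 0 := by rw [hu, sub_self]
      · simp only [sg_zero, sg_one, one_smul, neg_smul] at hu
        rw [zadd_self, two_smul]
        calc f 0 + f 0 = (f 0 + -f 1) - (-(f 0 + f 1)) := by abel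
          _ = 0 := by rw [hu, sub_self]
    exact (smul_eq_zero.mp this).resolve_left h2
  have hfe : f 0 + f 1 = f ε := by
    rcases zcases ε with rfl | rfl
    · rw [zero_add] at hz
      rw [hz, add_zero]
    · rw [zadd_self] at hz
      rw [hz, zero_add]
  rw [hfe]
  exact (hf ε).2 v

end Enveloping

section Supermodules

variable {k : Type u} [Field k]

/-- A `U(q)`-supermodule, i.e. a superspace with an action of the Lie superalgebra `q(V)`.
As the characteristic is not two, the grading is recorded by the parity involution
`par m = (-1)^{|m|} m`. -/
structure SMod (s : k) (n : ℕ) where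
  carrier : Type u
  [acg : AddCommGroup carrier]
  [mod : Module k carrier]
  par : carrier →ₗ[k] carrier
  par_par : ∀ m, par (par m) = m
  act : ∀ ε : ZMod 2, q s n ε →ₗ[k] Module.End k carrier
  par_act : ∀ ε (x : q s n ε) m, par (act ε x m) = sg k ε • act ε x (par m)
  act_br : ∀ ε δ (x : q s n ε) (y : q s n δ) m,
    act (ε + δ) (br x y) m = act ε x (act δ y m) - sg k (ε * δ) • act δ y (act ε x m)

attribute [instance] SMod.acg SMod.mod

variable {s : k} {n : ℕ}

namespace SMod

/-- The map `m ↦ (-1)^{ε|m|} m`. -/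
def pp (M : SMod s n) (ε : ZMod 2) : M.carrier →ₗ[k] M.carrier :=
  if ε = 0 then LinearMap.id else M.par

@[simp] theorem pp_zero (M : SMod s n) : M.pp 0 = LinearMap.id := rfl

@[simp] theorem pp_one (M : SMod s n) : M.pp 1 = M.par := rfl

theorem pp_pp (M : SMod s n) (ε δ : ZMod 2) (m : M.carrier) :
    M.pp ε (M.pp δ m) = M.pp (ε + δ) m := by
  rcases zcases ε with rfl | rfl <;> rcases zcases δ with rfl | rfl <;>
    simp [zadd_self, M.par_par]

theorem pp_act (M : SMod s n) (ε δ : ZMod 2) (x : q s n δ) (m : M.carrier) :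
    M.pp ε (M.act δ x m) = sg k (ε * δ) • M.act δ x (M.pp ε m) := by
  rcases zcases ε with rfl | rfl <;> simp [M.par_act]

end SMod

/-- A homomorphism of supermodules of parity `ε`: a linear map `f` with `|f(m)| = ε + |m|` and
`f(x m) = (-1)^{ε|x|} x f(m)`. -/
structure IsHom {M N : SMod s n} (ε : ZMod 2) (f : M.carrier →ₗ[k] N.carrier) : Prop where
  par : ∀ m, N.par (f m) = sg k ε • f (M.par m)
  act : ∀ δ (x : q s n δ) m, f (M.act δ x m) = sg k (ε * δ) • N.act δ x (f m)

theorem IsHom.pp {M N : SMod s n} {ε : ZMod 2} {f : M.carrier →ₗ[k] N.carrier} (h : IsHom ε f)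
    (δ : ZMod 2) (m : M.carrier) : N.pp δ (f m) = sg k (δ * ε) • f (M.pp δ m) := by
  rcases zcases δ with rfl | rfl <;> simp [h.par]

/-- `U(q)` as a supermodule over itself by left multiplication. -/
def regular (s : k) (n : ℕ) : SMod s n where
  carrier := U s n
  par := (parU s n).toLinearMap
  par_par := parU_parU
  act ε := (LinearMap.mul k (U s n)) ∘ₗ ι ε
  par_act ε x m := by simp
  act_br ε δ x y m := by simp [ι_br, mul_assoc]

/-- The tensor product of supermodules:
`x · (m ⊗ m') = (x · m) ⊗ m' + (-1)^{|x||m|} m ⊗ (x · m')`. -/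
def tens (M N : SMod s n) : SMod s n where
  carrier := M.carrier ⊗[k] N.carrier
  par := TensorProduct.map M.par N.par
  par_par m := by
    induction m with
    | zero => simp
    | tmul a b => simp [M.par_par, N.par_par]
    | add a b ha hb => simp [ha, hb]
  act ε :=
    { toFun := fun x => TensorProduct.map (M.act ε x) LinearMap.id
        + TensorProduct.map (M.pp ε) (N.act ε x)
      map_add' := by
        intro x y
        simp only [map_add, TensorProduct.map_add_left, TensorProduct.map_add_right]
        abel
      map_smul' := by
        intro r x
        simp [TensorProduct.map_smul_left, TensorProduct.map_smul_right] }
  par_act ε x m := by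
    induction m with
    | zero => simp
    | tmul a b =>
      have h : M.par (M.pp ε a) = M.pp ε (M.par a) := by
        rw [← M.pp_one, M.pp_pp, M.pp_pp, add_comm]
      simp [M.par_act, N.par_act, TensorProduct.smul_tmul', TensorProduct.tmul_smul, h]
    | add a b ha hb => simp only [map_add, ha, hb, smul_add]
  act_br ε δ x y m := by
    induction m with
    | zero => simp
    | tmul a b =>
      simp only [LinearMap.coe_mk, AddHom.coe_mk, LinearMap.add_apply, TensorProduct.map_tmul,
        LinearMap.id_apply, map_add, M.act_br, N.act_br, M.pp_act, M.pp_pp, add_comm δ ε,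
        TensorProduct.sub_tmul, TensorProduct.tmul_sub, TensorProduct.smul_tmul',
        TensorProduct.tmul_smul, smul_add, smul_smul, mul_comm δ ε, sg_sq, one_smul]
      abel
    | add a b ha hb =>
      simp only [map_add, ha, hb, smul_add]
      abel

/-- The pure tensor `a ⊗ m`. -/
def tm (A M : SMod s n) : A.carrier →ₗ[k] M.carrier →ₗ[k] (tens A M).carrier :=
  TensorProduct.mk k A.carrier M.carrier

/-- The linear map `a ⊗ m ↦ f(a) ⊗ g(m)`, without sign. -/
def tensMap {A B M N : SMod s n} (f : A.carrier →ₗ[k] B.carrier)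
    (g : M.carrier →ₗ[k] N.carrier) : (tens A M).carrier →ₗ[k] (tens B N).carrier :=
  TensorProduct.map f g

/-- The linear endomorphism of `V` with a given matrix. -/
abbrev glAct : Matrix (Idx n) (Idx n) k →ₗ[k] Module.End k (V k n) :=
  (Matrix.toLin' : Matrix (Idx n) (Idx n) k ≃ₗ[k] (V k n →ₗ[k] V k n)).toLinearMap

/-- The parity involution of `V`. -/
def parV (k : Type u) [Field k] (n : ℕ) : V k n →ₗ[k] V k n where
  toFun v a := sg k a.2 * v a
  map_add' v w := by
    ext a
    simp [mul_add]
  map_smul' r v := by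
    ext a
    simp [mul_left_comm]

theorem gl_parV {ε : ZMod 2} {x : Matrix (Idx n) (Idx n) k} (hx : x ∈ gl k n ε) (v : V k n) :
    parV k n (glAct x v) = sg k ε • glAct x (parV k n v) := by
  ext a
  simp only [parV, LinearMap.coe_mk, AddHom.coe_mk, LinearEquiv.coe_coe, Matrix.toLin'_apply,
    Matrix.mulVec, dotProduct, Pi.smul_apply, smul_eq_mul, Finset.mul_sum]
  refine Finset.sum_congr rfl fun b _ => ?_
  by_cases h : a.2 + b.2 = ε
  · rw [← h, sg_add]
    linear_combination (-(sg k a.2 * x a b * v b)) * sg_sq (k := k) b.2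
  · simp [hx a b h]

theorem glAct_br {ε δ : ZMod 2} (x y : Matrix (Idx n) (Idx n) k) (v : V k n) :
    glAct (sbr ε δ x y) v = glAct x (glAct y v) - sg k (ε * δ) • glAct y (glAct x v) := by
  simp [sbr, Matrix.toLin'_mul]

/-- The natural supermodule `V`. -/
def natV (s : k) (n : ℕ) : SMod s n where
  carrier := V k n
  par := parV k n
  par_par v := by
    ext a
    simp [parV, ← mul_assoc]
  act ε := glAct ∘ₗ (q s n ε).subtype
  par_act ε x v := gl_parV x.2.1 v
  act_br ε δ x y v := glAct_br x.1 y.1 v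

/-- The basis vector `v_a` of `V`. -/
def vb (s : k) {n : ℕ} (a : Idx n) : (natV s n).carrier :=
  (Pi.single a 1 : V k n)

/-- The action of a matrix on `V`. -/
def natAct (s : k) {n : ℕ} (x : Matrix (Idx n) (Idx n) k) :
    (natV s n).carrier →ₗ[k] (natV s n).carrier :=
  glAct x

/-- The projection of `V` onto `V_ε`. -/
def prV (s : k) (n : ℕ) (ε : ZMod 2) : (natV s n).carrier →ₗ[k] (natV s n).carrier :=
  glAct (Matrix.diagonal fun a : Idx n => if a.2 = ε then 1 else 0)

/-- The action of `x ∈ q(V)_ε` on `M^* = Hom(M, k)`: `(x · f)(m) = -(-1)^{|x||f|} f(x · m)`,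
where `(-1)^{|f|} f = f ∘ par`. -/
def dualAct (M : SMod s n) (ε : ZMod 2) : q s n ε →ₗ[k] Module.End k (M.carrier →ₗ[k] k) where
  toFun x :=
    { toFun := fun f => -((f ∘ₗ M.pp ε) ∘ₗ M.act ε x)
      map_add' := fun f g => LinearMap.ext fun m => by simp [add_comm]
      map_smul' := fun r f => LinearMap.ext fun m => by simp }
  map_add' x y := LinearMap.ext fun f => LinearMap.ext fun m => by
    change -f (M.pp ε (M.act ε (x + y) m))
      = -f (M.pp ε (M.act ε x m)) + -f (M.pp ε (M.act ε y m))
    rw [map_add, LinearMap.add_apply, map_add, map_add, neg_add]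
  map_smul' r x := LinearMap.ext fun f => LinearMap.ext fun m => by
    change -f (M.pp ε (M.act ε (r • x) m)) = r • -f (M.pp ε (M.act ε x m))
    rw [map_smul, LinearMap.smul_apply, map_smul, map_smul, smul_neg]

theorem dualAct_apply (M : SMod s n) (ε : ZMod 2) (x : q s n ε) (f : M.carrier →ₗ[k] k)
    (m : M.carrier) : dualAct M ε x f m = -f (M.pp ε (M.act ε x m)) := rfl

/-- The dual supermodule `M^*`. -/
def dual (M : SMod s n) : SMod s n where
  carrier := M.carrier →ₗ[k] k
  par :=
    { toFun := fun f => f ∘ₗ M.par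
      map_add' := fun f g => rfl
      map_smul' := fun r f => rfl }
  par_par f := LinearMap.ext fun m => by simp [M.par_par]
  act ε := dualAct M ε
  par_act ε x f := LinearMap.ext fun m => by
    have h : M.pp ε (M.act ε x (M.par m)) = sg k ε • M.par (M.pp ε (M.act ε x m)) := by
      rw [← M.pp_one, M.pp_pp, add_comm 1, ← M.pp_pp, M.pp_act 1, map_smul, one_mul, smul_smul,
        sg_sq, one_smul]
    simp [dualAct_apply, h]
  act_br ε δ x y f := LinearMap.ext fun m => by
    simp only [LinearMap.sub_apply, LinearMap.smul_apply, dualAct_apply, M.act_br, M.pp_act,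
      M.pp_pp, map_sub, map_smul, smul_eq_mul, mul_neg, neg_neg, add_comm δ ε,
      mul_comm δ ε]
    rcases zcases ε with rfl | rfl <;> rcases zcases δ with rfl | rfl <;> simp [zadd_self]
    ring

/-- The dual basis vector `v_a^*` of `V^*`. -/
def vd (s : k) {n : ℕ} (a : Idx n) : (dual (natV s n)).carrier :=
  (LinearMap.proj a : V k n →ₗ[k] k)

/-- The evaluation pairing of `M^*` and `M`. -/
def pair (M : SMod s n) : (dual M).carrier →ₗ[k] M.carrier →ₗ[k] k :=
  LinearMap.id

end Supermodules

section Diagrams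

/-- The generating objects `↑` and `↓`. -/
inductive Letter : Type
  | up
  | down

open Letter

/-- The generating morphisms `g : a → b` of `AOBC`, with their parity: the cup `1 → ↑↓`, the cap
`↓↑ → 1`, the upward crossing, the inverse `↑↓ → ↓↑` of the rotated crossing, the black dot and
the white dot. -/
inductive Gen : List Letter → List Letter → ZMod 2 → Type
  | cup : Gen [] [up, down] 0
  | cap : Gen [down, up] [] 0
  | swap : Gen [up, up] [up, up] 0
  | rswap : Gen [up, down] [down, up] 0
  | dot : Gen [up] [up] 0
  | cdot : Gen [up] [up] 1

/-- Expressions for homogeneous morphisms of parity `ε` in the strict monoidal supercategory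
generated by `Gen`: `gen g r` stands for `g ⊗ 1_r` and `lwh l f` for `1_l ⊗ f`. -/
inductive Mor (k : Type u) : List Letter → List Letter → ZMod 2 → Type u
  | id (a : List Letter) : Mor k a a 0
  | gen {a b : List Letter} {ε : ZMod 2} (g : Gen a b ε) (r : List Letter) :
      Mor k (a ++ r) (b ++ r) ε
  | lwh {a b : List Letter} {ε : ZMod 2} (l : Letter) (f : Mor k a b ε) :
      Mor k (l :: a) (l :: b) ε
  | comp {a b c : List Letter} {ε δ η : ZMod 2} (h : ε + δ = η) (f : Mor k b c ε)
      (g : Mor k a b δ) : Mor k a c η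
  | zero (a b : List Letter) (ε : ZMod 2) : Mor k a b ε
  | add {a b : List Letter} {ε : ZMod 2} (f g : Mor k a b ε) : Mor k a b ε
  | smul {a b : List Letter} {ε : ZMod 2} (r : k) (f : Mor k a b ε) : Mor k a b ε

namespace Mor

variable {k : Type u}

/-- `1_x ⊗ f`. -/
def lwhs {a b : List Letter} {ε : ZMod 2} (f : Mor k a b ε) :
    ∀ x : List Letter, Mor k (x ++ a) (x ++ b) ε
  | [] => f
  | l :: x => lwh l (lwhs f x)

variable (k) (r : List Letter)

/-- `cup ⊗ 1_r`. -/
def cup : Mor k r (up :: down :: r) 0 := gen Gen.cup r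

/-- `cap ⊗ 1_r`. -/
def cap : Mor k (down :: up :: r) r 0 := gen Gen.cap r

/-- The upward crossing, tensored with `1_r`. -/
def swap : Mor k (up :: up :: r) (up :: up :: r) 0 := gen Gen.swap r

/-- The crossing `↑↓ → ↓↑`, tensored with `1_r`. -/
def rswap : Mor k (up :: down :: r) (down :: up :: r) 0 := gen Gen.rswap r

/-- The black dot, tensored with `1_r`. -/
def dot : Mor k (up :: r) (up :: r) 0 := gen Gen.dot r

/-- The white dot, tensored with `1_r`. -/
def cdot : Mor k (up :: r) (up :: r) 1 := gen Gen.cdot r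

/-- The crossing `↓↑ → ↑↓` obtained by rotating the upward crossing, tensored with `1_r`. -/
def lswap : Mor k (down :: up :: r) (up :: down :: r) 0 :=
  comp (add_zero 0) (cap k (up :: down :: r))
    (comp (add_zero 0) (lwh down (swap k (down :: r))) (lwh down (lwh up (cup k r))))

/-- The rightward cup `1 → ↓↑`, tensored with `1_r`. -/
def rcup : Mor k r (down :: up :: r) 0 := comp (add_zero 0) (rswap k r) (cup k r)

/-- The vertical composition of `m` black dots, tensored with `1_r`. -/
def dots : ℕ → Mor k (up :: r) (up :: r) 0
  | 0 => id _
  | m + 1 => comp (add_zero 0) (dot k r) (dots m)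

end Mor

open Mor

/-- The relation of equality of morphisms in `AOBC`: the axioms of a `k`-linear strict monoidal
supercategory, followed by the defining relations of `AOBC`. -/
inductive Rel {k : Type u} [Field k] :
    ∀ {a b : List Letter} {ε : ZMod 2}, Mor k a b ε → Mor k a b ε → Prop
  | refl {a b ε} (f : Mor k a b ε) : Rel f f
  | symm {a b ε} {f g : Mor k a b ε} : Rel f g → Rel g f
  | trans {a b ε} {f g h : Mor k a b ε} : Rel f g → Rel g h → Rel f h
  | comp {a b c ε δ η} (h : ε + δ = η) {f f' : Mor k b c ε} {g g' : Mor k a b δ} :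
      Rel f f' → Rel g g' → Rel (comp h f g) (comp h f' g')
  | lwh {a b ε} (l : Letter) {f f' : Mor k a b ε} : Rel f f' → Rel (lwh l f) (lwh l f')
  | add {a b ε} {f f' g g' : Mor k a b ε} : Rel f f' → Rel g g' → Rel (add f g) (add f' g')
  | smul {a b ε} (r : k) {f f' : Mor k a b ε} : Rel f f' → Rel (smul r f) (smul r f')
  | id_comp {a b ε} (f : Mor k a b ε) : Rel (Mor.comp (zero_add ε) (id b) f) f
  | comp_id {a b ε} (f : Mor k a b ε) : Rel (Mor.comp (add_zero ε) f (id a)) f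
  | assoc {a b c d ε₁ ε₂ ε₃ η₁ η₂ η} (h₁ : ε₁ + ε₂ = η₁) (h : η₁ + ε₃ = η) (h₂ : ε₂ + ε₃ = η₂)
      (h' : ε₁ + η₂ = η) (f₁ : Mor k c d ε₁) (f₂ : Mor k b c ε₂) (f₃ : Mor k a b ε₃) :
      Rel (Mor.comp h (Mor.comp h₁ f₁ f₂) f₃) (Mor.comp h' f₁ (Mor.comp h₂ f₂ f₃))
  | add_assoc {a b ε} (f g h : Mor k a b ε) :
      Rel (Mor.add (Mor.add f g) h) (Mor.add f (Mor.add g h))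
  | add_comm {a b ε} (f g : Mor k a b ε) : Rel (Mor.add f g) (Mor.add g f)
  | zero_add {a b ε} (f : Mor k a b ε) : Rel (Mor.add (zero a b ε) f) f
  | zero_smul {a b ε} (f : Mor k a b ε) : Rel (Mor.smul 0 f) (zero a b ε)
  | one_smul {a b ε} (f : Mor k a b ε) : Rel (Mor.smul 1 f) f
  | mul_smul {a b ε} (r r' : k) (f : Mor k a b ε) :
      Rel (Mor.smul (r * r') f) (Mor.smul r (Mor.smul r' f))
  | add_smul {a b ε} (r r' : k) (f : Mor k a b ε) :
      Rel (Mor.smul (r + r') f) (Mor.add (Mor.smul r f) (Mor.smul r' f))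
  | smul_add {a b ε} (r : k) (f g : Mor k a b ε) :
      Rel (Mor.smul r (Mor.add f g)) (Mor.add (Mor.smul r f) (Mor.smul r g))
  | comp_add {a b c ε δ η} (h : ε + δ = η) (f : Mor k b c ε) (g g' : Mor k a b δ) :
      Rel (Mor.comp h f (Mor.add g g')) (Mor.add (Mor.comp h f g) (Mor.comp h f g'))
  | add_comp {a b c ε δ η} (h : ε + δ = η) (f f' : Mor k b c ε) (g : Mor k a b δ) :
      Rel (Mor.comp h (Mor.add f f') g) (Mor.add (Mor.comp h f g) (Mor.comp h f' g))
  | comp_smul {a b c ε δ η} (h : ε + δ = η) (r : k) (f : Mor k b c ε) (g : Mor k a b δ) :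
      Rel (Mor.comp h f (Mor.smul r g)) (Mor.smul r (Mor.comp h f g))
  | smul_comp {a b c ε δ η} (h : ε + δ = η) (r : k) (f : Mor k b c ε) (g : Mor k a b δ) :
      Rel (Mor.comp h (Mor.smul r f) g) (Mor.smul r (Mor.comp h f g))
  | lwh_id (l : Letter) (a : List Letter) : Rel (Mor.lwh l (id a)) (id (l :: a))
  | lwh_comp {a b c ε δ η} (l : Letter) (h : ε + δ = η) (f : Mor k b c ε) (g : Mor k a b δ) :
      Rel (Mor.lwh l (Mor.comp h f g)) (Mor.comp h (Mor.lwh l f) (Mor.lwh l g))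
  | lwh_add {a b ε} (l : Letter) (f g : Mor k a b ε) :
      Rel (Mor.lwh l (Mor.add f g)) (Mor.add (Mor.lwh l f) (Mor.lwh l g))
  | lwh_smul {a b ε} (l : Letter) (r : k) (f : Mor k a b ε) :
      Rel (Mor.lwh l (Mor.smul r f)) (Mor.smul r (Mor.lwh l f))
  /-- The super-interchange law `(g ⊗ 1)(1 ⊗ f) = (-1)^{|g||f|} (1 ⊗ f)(g ⊗ 1)`. -/
  | interchange {x y a b ε δ} (g : Gen x y ε) (f : Mor k a b δ) :
      Rel (Mor.comp rfl (gen g b) (lwhs f x))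
        (Mor.smul (sg k (ε * δ)) (Mor.comp (_root_.add_comm δ ε) (lwhs f y) (gen g a)))
  | swap_swap (r : List Letter) :
      Rel (Mor.comp (_root_.add_zero 0) (swap k r) (swap k r)) (id (up :: up :: r))
  | braid (r : List Letter) :
      Rel (Mor.comp (_root_.add_zero 0) (swap k (up :: r))
          (Mor.comp (_root_.add_zero 0) (Mor.lwh up (swap k r)) (swap k (up :: r))))
        (Mor.comp (_root_.add_zero 0) (Mor.lwh up (swap k r))
          (Mor.comp (_root_.add_zero 0) (swap k (up :: r)) (Mor.lwh up (swap k r))))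
  | zigzag_up (r : List Letter) :
      Rel (Mor.comp (_root_.add_zero 0) (Mor.lwh up (cap k r)) (cup k (up :: r))) (id (up :: r))
  | zigzag_down (r : List Letter) :
      Rel (Mor.comp (_root_.add_zero 0) (cap k (down :: r)) (Mor.lwh down (cup k r)))
        (id (down :: r))
  | rswap_lswap (r : List Letter) :
      Rel (Mor.comp (_root_.add_zero 0) (rswap k r) (lswap k r)) (id (down :: up :: r))
  | lswap_rswap (r : List Letter) :
      Rel (Mor.comp (_root_.add_zero 0) (lswap k r) (rswap k r)) (id (up :: down :: r))
  | cdot_cdot (r : List Letter) :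
      Rel (Mor.comp (zadd_self 1) (cdot k r) (cdot k r)) (id (up :: r))
  | swap_cdot (r : List Letter) :
      Rel (Mor.comp (_root_.zero_add 1) (swap k r) (cdot k (up :: r)))
        (Mor.comp (_root_.add_zero 1) (Mor.lwh up (cdot k r)) (swap k r))
  | cdot_bubble (r : List Letter) :
      Rel (Mor.comp (_root_.zero_add 1) (cap k r)
          (Mor.comp (_root_.add_zero 1) (Mor.lwh down (cdot k r)) (rcup k r)))
        (zero r r 1)
  | dot_cdot (r : List Letter) :
      Rel (Mor.comp (_root_.zero_add 1) (dot k r) (cdot k r))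
        (Mor.smul (-1) (Mor.comp (_root_.add_zero 1) (cdot k r) (dot k r)))
  | dot_swap (r : List Letter) :
      Rel (Mor.add (Mor.comp (_root_.add_zero 0) (dot k (up :: r)) (swap k r))
          (Mor.smul (-1) (Mor.comp (_root_.add_zero 0) (swap k r) (Mor.lwh up (dot k r)))))
        (Mor.add (id (up :: up :: r))
          (Mor.smul (-1)
            (Mor.comp (zadd_self 1) (cdot k (up :: r)) (Mor.lwh up (cdot k r)))))

/-- The space `Hom_AOBC(a, b)_ε` of morphisms of parity `ε`. -/
def Hom (k : Type u) [Field k] (a b : List Letter) (ε : ZMod 2) : Type u :=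
  Quot (Rel (k := k) (a := a) (b := b) (ε := ε))

/-- The counterclockwise bubble `Δ_m` with `m` black dots on its upward strand. -/
def Δ (k : Type u) [Field k] (m : ℕ) : Hom k [] [] 0 :=
  Quot.mk _ (comp (add_zero 0) (cap k [])
    (comp (add_zero 0) (lwh down (dots k [] m)) (rcup k [])))

end Diagrams

section Functor

open Letter

variable {k : Type u} [Field k] {s : k} {n : ℕ}

/-- `V^↑ = V` and `V^↓ = V^*`. -/
def lmod (s : k) (n : ℕ) : Letter → SMod s n
  | up => natV s n
  | down => dual (natV s n)

/-- The endofunctor `V^a ⊗ -` on objects. -/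
def obj : List Letter → SMod s n → SMod s n
  | [], M => M
  | l :: a, M => tens (lmod s n l) (obj a M)

/-- `1_A ⊗ f` for a homogeneous `f` of parity `ε`: `v ⊗ m ↦ (-1)^{ε|v|} v ⊗ f(m)`. -/
def tensHom (A : SMod s n) {M N : SMod s n} (ε : ZMod 2) (f : M.carrier →ₗ[k] N.carrier) :
    (tens A M).carrier →ₗ[k] (tens A N).carrier :=
  tensMap (A.pp ε) f

/-- The endofunctor `V^a ⊗ -` on homogeneous morphisms of parity `ε`. -/
def objMap (ε : ZMod 2) {M N : SMod s n} (f : M.carrier →ₗ[k] N.carrier) :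
    ∀ a : List Letter, (obj a M).carrier →ₗ[k] (obj a N).carrier
  | [] => f
  | l :: a => tensHom (lmod s n l) ε (objMap ε f a)

/-- `m ↦ ∑_a v_a ⊗ v_a^* ⊗ m`. -/
def cupMap (N : SMod s n) :
    N.carrier →ₗ[k] (tens (natV s n) (tens (dual (natV s n)) N)).carrier :=
  ∑ a : Idx n, tm (natV s n) (tens (dual (natV s n)) N) (vb s a) ∘ₗ
    tm (dual (natV s n)) N (vd s a)

/-- `f ⊗ v ⊗ m ↦ f(v) m`. -/
def capMap (N : SMod s n) :
    (tens (dual (natV s n)) (tens (natV s n) N)).carrier →ₗ[k] N.carrier :=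
  TensorProduct.lift
    ((TensorProduct.lift.equiv (RingHom.id k) (natV s n).carrier N.carrier N.carrier).toLinearMap ∘ₗ
      ((LinearMap.lsmul k N.carrier).compRight k ∘ₗ pair (natV s n)))

/-- The map `a ⊗ b ⊗ m ↦ b ⊗ a ⊗ m`, without sign. -/
def lcomm (A B N : SMod s n) :
    (tens A (tens B N)).carrier →ₗ[k] (tens B (tens A N)).carrier :=
  (TensorProduct.leftComm k A.carrier B.carrier N.carrier).toLinearMap

/-- `u ⊗ w ⊗ m ↦ (-1)^{|u||w|} w ⊗ u ⊗ m` for `u ∈ V` and `w ∈ B`. -/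
def flipMap (B N : SMod s n) :
    (tens (natV s n) (tens B N)).carrier →ₗ[k] (tens B (tens (natV s n) N)).carrier :=
  ∑ ε : ZMod 2, lcomm (natV s n) B N ∘ₗ tensMap (prV s n ε) (tensMap (B.pp ε) LinearMap.id)

/-- The action of the Casimir element `Ω = ∑ ẽ_{i,j}^ε ⊗ e_{j,i}^ε` on `V ⊗ N`:
`Ω(v ⊗ m) = ∑ (-1)^{ε|v|} ẽ_{i,j}^ε v ⊗ e_{j,i}^ε m`. -/
def casimir (N : SMod s n) : (tens (natV s n) N).carrier →ₗ[k] (tens (natV s n) N).carrier :=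
  ∑ ε : ZMod 2, ∑ i : Fin n, ∑ j : Fin n,
    tensMap (natAct s (etMat ε i j) ∘ₗ (natV s n).pp ε) (N.act ε (e s ε j i))

/-- `v ⊗ m ↦ c(v) ⊗ m`. -/
def cMap (N : SMod s n) : (tens (natV s n) N).carrier →ₗ[k] (tens (natV s n) N).carrier :=
  tensMap (natAct s (cMat s)) LinearMap.id

/-- The values of `Ψ` on generators: `Ψ(g ⊗ 1_r)_M = Ψ(g)_{V^r ⊗ M}`. -/
def genMap (r : List Letter) (M : SMod s n) : ∀ {a b : List Letter} {ε : ZMod 2}, Gen a b ε →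
    ((obj (a ++ r) M).carrier →ₗ[k] (obj (b ++ r) M).carrier)
  | _, _, _, Gen.cup => cupMap (obj r M)
  | _, _, _, Gen.cap => capMap (obj r M)
  | _, _, _, Gen.swap => flipMap (natV s n) (obj r M)
  | _, _, _, Gen.rswap => flipMap (dual (natV s n)) (obj r M)
  | _, _, _, Gen.dot => casimir (obj r M)
  | _, _, _, Gen.cdot => cMap (obj r M)

/-- The value of `Ψ` on expressions. -/
def Mor.eval (M : SMod s n) : ∀ {a b : List Letter} {ε : ZMod 2}, Mor k a b ε →
    ((obj a M).carrier →ₗ[k] (obj b M).carrier)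
  | _, _, _, .id _ => LinearMap.id
  | _, _, _, .gen g r => genMap r M g
  | _, _, ε, .lwh l f => tensHom (lmod s n l) ε (f.eval M)
  | _, _, _, .comp _ f g => f.eval M ∘ₗ g.eval M
  | _, _, _, .zero _ _ _ => 0
  | _, _, _, .add f g => f.eval M + g.eval M
  | _, _, _, .smul r f => r • f.eval M

end Functor

section Verification

open Letter

variable {k : Type u} [Field k] {s : k} {n : ℕ}

theorem tens_induction {A M : SMod s n} {P : (tens A M).carrier → Prop} (h0 : P 0)
    (ht : ∀ a m, P (tm A M a m)) (ha : ∀ x y, P x → P y → P (x + y)) (x : (tens A M).carrier) :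
    P x :=
  TensorProduct.induction_on (motive := P) x h0 ht ha

theorem tens_ext {A M : SMod s n} {P : Type u} [AddCommGroup P] [Module k P]
    {f g : (tens A M).carrier →ₗ[k] P} (h : ∀ a m, f (tm A M a m) = g (tm A M a m)) : f = g :=
  TensorProduct.ext' h

theorem natV_induction {P : (natV s n).carrier → Prop} (h0 : P 0) (hb : ∀ a, P (vb s a))
    (hs : ∀ (r : k) v, P v → P (r • v)) (ha : ∀ x y, P x → P y → P (x + y))
    (v : (natV s n).carrier) : P v := by
  have aux : ∀ w : V k n, w = ∑ a : Idx n, w a • (Pi.single a 1 : V k n) := by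
    intro w
    ext b
    simp [Pi.single_apply]
  have h : v = ∑ a : Idx n, (v : V k n) a • vb s a := aux v
  rw [h]
  exact Finset.sum_induction _ _ ha h0 fun a _ => hs _ _ (hb a)

theorem natV_ext' {P : Type u} [AddCommGroup P] [Module k P]
    {f g : (natV s n).carrier →ₗ[k] P} (h : ∀ a, f (vb s a) = g (vb s a)) : f = g := by
  ext v
  induction v using natV_induction with
  | h0 => simp
  | hb a => exact h a
  | hs r v hv => simp [hv]
  | ha v w hv hw => simp [hv, hw]

theorem natV_ext {M : SMod s n} {P : Type u} [AddCommGroup P] [Module k P]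
    {f g : (tens (natV s n) M).carrier →ₗ[k] P}
    (h : ∀ a m, f (tm (natV s n) M (vb s a) m) = g (tm (natV s n) M (vb s a) m)) : f = g := by
  refine tens_ext fun v m => ?_
  induction v using natV_induction with
  | h0 => simp
  | hb a => exact h a m
  | hs r v hv => simp [hv]
  | ha v w hv hw => simp [hv, hw]

theorem tensMap_tm {A B M N : SMod s n} (f : A.carrier →ₗ[k] B.carrier)
    (g : M.carrier →ₗ[k] N.carrier) (a : A.carrier) (m : M.carrier) :
    tensMap f g (tm A M a m) = tm B N (f a) (g m) := rfl

theorem tensHom_tm (A : SMod s n) {M N : SMod s n} (ε : ZMod 2)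
    (f : M.carrier →ₗ[k] N.carrier) (a : A.carrier) (m : M.carrier) :
    tensHom A ε f (tm A M a m) = tm A N (A.pp ε a) (f m) := rfl

theorem lcomm_tm (A B N : SMod s n) (a : A.carrier) (b : B.carrier) (m : N.carrier) :
    lcomm A B N (tm A (tens B N) a (tm B N b m)) = tm B (tens A N) b (tm A N a m) := rfl

theorem par_tm (A M : SMod s n) (a : A.carrier) (m : M.carrier) :
    (tens A M).par (tm A M a m) = tm A M (A.par a) (M.par m) := rfl

theorem pp_tm (A M : SMod s n) (ε : ZMod 2) (a : A.carrier) (m : M.carrier) :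
    (tens A M).pp ε (tm A M a m) = tm A M (A.pp ε a) (M.pp ε m) := by
  rcases zcases ε with rfl | rfl
  · rfl
  · rfl

theorem act_tm (A M : SMod s n) (ε : ZMod 2) (x : q s n ε) (a : A.carrier) (m : M.carrier) :
    (tens A M).act ε x (tm A M a m)
      = tm A M (A.act ε x a) m + tm A M (A.pp ε a) (M.act ε x m) := rfl

theorem cupMap_apply (N : SMod s n) (m : N.carrier) :
    cupMap N m = ∑ a : Idx n, tm (natV s n) (tens (dual (natV s n)) N) (vb s a)
      (tm (dual (natV s n)) N (vd s a) m) := by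
  simp only [cupMap, LinearMap.sum_apply, LinearMap.comp_apply]

theorem capMap_tm (N : SMod s n) (f : (dual (natV s n)).carrier) (v : (natV s n).carrier)
    (m : N.carrier) :
    capMap N (tm (dual (natV s n)) (tens (natV s n) N) f (tm (natV s n) N v m))
      = pair (natV s n) f v • m := rfl

theorem pair_vd_vb (a b : Idx n) : pair (natV s n) (vd s a) (vb s b) = if a = b then 1 else 0 := by
  change (Pi.single b 1 : V k n) a = _
  rw [Pi.single_apply]

theorem pair_pp (M : SMod s n) (ε : ZMod 2) (f : (dual M).carrier) (m : M.carrier) :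
    pair M ((dual M).pp ε f) m = pair M f (M.pp ε m) := by
  rcases zcases ε with rfl | rfl
  · rfl
  · rfl

theorem pair_act (M : SMod s n) (ε : ZMod 2) (x : q s n ε) (f : (dual M).carrier)
    (m : M.carrier) :
    pair M ((dual M).act ε x f) m = -pair M f (M.pp ε (M.act ε x m)) := rfl

theorem natAct_vb (x : Matrix (Idx n) (Idx n) k) (b : Idx n) :
    natAct s x (vb s b) = ∑ a, x a b • vb s a := by
  change glAct x (Pi.single b 1 : V k n) = ∑ a : Idx n, x a b • (Pi.single a 1 : V k n)
  ext a
  simp [Pi.single_apply]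

theorem act_natV (ε : ZMod 2) (x : q s n ε) (v : (natV s n).carrier) :
    (natV s n).act ε x v = natAct s x.1 v := rfl

theorem par_vb (a : Idx n) : (natV s n).par (vb s a) = sg k a.2 • vb s a := by
  change parV k n (Pi.single a 1 : V k n) = sg k a.2 • (Pi.single a 1 : V k n)
  ext b
  by_cases h : b = a
  · subst h; simp [parV]
  · simp [parV, h]

theorem pp_vb (ε : ZMod 2) (a : Idx n) :
    (natV s n).pp ε (vb s a) = sg k (ε * a.2) • vb s a := by
  rcases zcases ε with rfl | rfl
  · rw [SMod.pp_zero, zero_mul, sg_zero, one_smul]; rfl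
  · rw [SMod.pp_one, par_vb, one_mul]

theorem prV_vb (ε : ZMod 2) (a : Idx n) :
    prV s n ε (vb s a) = if ε = a.2 then vb s a else 0 := by
  change natAct s _ (vb s a) = _
  rw [natAct_vb, Finset.sum_eq_single a]
  · simp [eq_comm]
  · intro b _ h
    rw [Matrix.diagonal_apply_ne _ h, zero_smul]
  · simp

theorem flipMap_vb (B N : SMod s n) (a : Idx n) (w : B.carrier) (m : N.carrier) :
    flipMap B N (tm (natV s n) (tens B N) (vb s a) (tm B N w m))
      = tm B (tens (natV s n) N) (B.pp a.2 w) (tm (natV s n) N (vb s a) m) := by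
  simp only [flipMap, LinearMap.sum_apply, LinearMap.comp_apply, tensMap_tm, lcomm_tm, prV_vb]
  rw [Finset.sum_eq_single a.2]
  · simp
  · intro ε _ h
    rw [if_neg h]
    simp
  · simp

theorem cMat_vb (b : Idx n) :
    natAct s (cMat s) (vb s b) = (sg k b.2 * s) • vb s (b.1, b.2 + 1) := by
  rw [natAct_vb, Finset.sum_eq_single (b.1, b.2 + 1)]
  · simp [cMat]
  · intro a _ h
    simp [cMat, h]
  · simp

theorem etMat_vb (ε : ZMod 2) (i j : Fin n) (b : Idx n) :
    natAct s (etMat ε i j) (vb s b) = if b.1 = j then sg k b.2 • vb s (i, b.2 + ε) else 0 := by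
  rw [natAct_vb, Finset.sum_eq_single (i, b.2 + ε)]
  · simp [etMat_apply]
  · intro a _ h
    simp [etMat_apply, h]
  · simp

theorem act_e_vb (ε : ZMod 2) (i j : Fin n) (b : Idx n) :
    (natV s n).act ε (e s ε i j) (vb s b) = if b.1 = j then vb s (i, b.2 + ε) else 0 := by
  rw [act_natV, natAct_vb, Finset.sum_eq_single (i, b.2 + ε)]
  · simp [e, eMat_apply]
  · intro a _ h
    simp [e, eMat_apply, h]
  · simp

theorem casimir_vb (N : SMod s n) (b : Idx n) (m : N.carrier) :
    casimir N (tm (natV s n) N (vb s b) m) = ∑ ε : ZMod 2, ∑ i : Fin n,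
      sg k (b.2 * (ε + 1)) • tm (natV s n) N (vb s (i, b.2 + ε)) (N.act ε (e s ε b.1 i) m) := by
  simp only [casimir, LinearMap.sum_apply, tensMap_tm, LinearMap.comp_apply, pp_vb, map_smul,
    etMat_vb]
  refine Finset.sum_congr rfl fun ε _ => Finset.sum_congr rfl fun i _ => ?_
  rw [Finset.sum_eq_single b.1]
  · simp [smul_smul, mul_add, sg_add, mul_comm]
  · intro j _ hj
    simp [Ne.symm hj]
  · simp

theorem cMap_vb (N : SMod s n) (b : Idx n) (m : N.carrier) :
    cMap N (tm (natV s n) N (vb s b) m)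
      = (sg k b.2 * s) • tm (natV s n) N (vb s (b.1, b.2 + 1)) m := by
  simp [cMap, tensMap_tm, cMat_vb]

end Verification

section Verification

open Letter

variable {k : Type u} [Field k] {s : k} {n : ℕ}

theorem sg_conj (a : ZMod 2) (r : k) : sg k a * r * sg k a = r := by
  rw [mul_right_comm, sg_sq, one_mul]

theorem pp_vd (ε : ZMod 2) (a : Idx n) :
    (dual (natV s n)).pp ε (vd s a) = sg k (ε * a.2) • vd s a := by
  have h : pair (natV s n) ((dual (natV s n)).pp ε (vd s a))
      = pair (natV s n) (sg k (ε * a.2) • vd s a) := by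
    refine natV_ext' fun b => ?_
    rw [pair_pp, pp_vb, map_smul, map_smul, LinearMap.smul_apply, pair_vd_vb]
    by_cases hab : a = b
    · subst hab; rfl
    · simp [hab]
  exact h

theorem isHom_id (M : SMod s n) : IsHom (M := M) (N := M) 0 LinearMap.id :=
  ⟨fun m => by simp, fun δ x m => by simp⟩

theorem isHom_comp {M N P : SMod s n} {ε δ η : ZMod 2} (h : ε + δ = η)
    {f : N.carrier →ₗ[k] P.carrier} {g : M.carrier →ₗ[k] N.carrier} (hf : IsHom ε f)
    (hg : IsHom δ g) : IsHom η (f ∘ₗ g) := by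
  subst h
  refine ⟨fun m => ?_, fun γ x m => ?_⟩
  · simp only [LinearMap.comp_apply, hf.par, hg.par, map_smul, smul_smul, sg_add]
  · simp only [LinearMap.comp_apply, hf.act, hg.act, map_smul, smul_smul, add_mul, sg_add,
      mul_comm (sg k (ε * γ))]

theorem isHom_zero (M N : SMod s n) (ε : ZMod 2) : IsHom (M := M) (N := N) ε 0 :=
  ⟨fun m => by simp, fun δ x m => by simp⟩

theorem isHom_add {M N : SMod s n} {ε : ZMod 2} {f g : M.carrier →ₗ[k] N.carrier}
    (hf : IsHom ε f) (hg : IsHom ε g) : IsHom ε (f + g) :=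
  ⟨fun m => by simp [hf.par, hg.par], fun δ x m => by simp [hf.act, hg.act]⟩

theorem isHom_smul {M N : SMod s n} {ε : ZMod 2} (r : k) {f : M.carrier →ₗ[k] N.carrier}
    (hf : IsHom ε f) : IsHom ε (r • f) :=
  ⟨fun m => by simp [hf.par, smul_comm r], fun δ x m => by simp [hf.act, smul_comm r]⟩

/-- To check that a map out of a tensor product is a homomorphism, it is enough to consider pure
tensors. -/
theorem isHom_of_tm {A M N : SMod s n} {ε : ZMod 2} {f : (tens A M).carrier →ₗ[k] N.carrier}
    (h1 : ∀ a m, N.par (f (tm A M a m)) = sg k ε • f ((tens A M).par (tm A M a m)))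
    (h2 : ∀ δ (x : q s n δ) a m, f ((tens A M).act δ x (tm A M a m))
      = sg k (ε * δ) • N.act δ x (f (tm A M a m))) : IsHom ε f := by
  refine ⟨fun m => ?_, fun δ x m => ?_⟩
  · induction m using tens_induction with
    | h0 => simp
    | ht a m => exact h1 a m
    | ha x y hx hy => simp only [map_add, hx, hy, smul_add]
  · induction m using tens_induction with
    | h0 => simp
    | ht a m => exact h2 δ x a m
    | ha x y hx hy => simp only [map_add, hx, hy, smul_add]

theorem isHom_tensHom (A : SMod s n) {M N : SMod s n} {ε : ZMod 2}
    {f : M.carrier →ₗ[k] N.carrier} (hf : IsHom ε f) : IsHom ε (tensHom A ε f) := by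
  refine isHom_of_tm (fun a m => ?_) (fun δ x a m => ?_)
  · simp only [tensHom_tm, ← SMod.pp_one, pp_tm, hf.pp, map_smul, A.pp_pp, add_comm, one_mul]
  · simp only [act_tm, tensHom_tm, map_add, hf.act, map_smul, smul_add, A.pp_act, A.pp_pp,
      LinearMap.smul_apply, add_comm]

theorem natAct_sum (x : Matrix (Idx n) (Idx n) k) {P : Type u} [AddCommGroup P] [Module k P]
    (f : (natV s n).carrier →ₗ[k] P) (b : Idx n) :
    f (natAct s x (vb s b)) = ∑ a, x a b • f (vb s a) := by
  rw [natAct_vb, map_sum]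
  simp only [map_smul]

theorem act_vd (ε : ZMod 2) (x : q s n ε) (a : Idx n) :
    (dual (natV s n)).act ε x (vd s a) = -∑ b, (sg k (ε * a.2) * x.1 a b) • vd s b := by
  have h : pair (natV s n) ((dual (natV s n)).act ε x (vd s a))
      = pair (natV s n) (-∑ b, (sg k (ε * a.2) * x.1 a b) • vd s b) := by
    refine natV_ext' fun b => ?_
    rw [pair_act, act_natV, natAct_vb, map_sum, map_sum, map_neg, LinearMap.neg_apply, map_sum,
      LinearMap.sum_apply]
    simp only [map_smul, pp_vb, LinearMap.smul_apply, pair_vd_vb]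
    rw [Finset.sum_eq_single a, Finset.sum_eq_single b]
    · simp [mul_comm]
    · intro d _ hd
      simp [hd]
    · simp
    · intro d _ hd
      simp [Ne.symm hd]
    · simp
  exact h

theorem isHom_cup (N : SMod s n) : IsHom 0 (cupMap N) := by
  refine ⟨fun m => ?_, fun δ x m => ?_⟩
  · simp only [cupMap_apply, map_sum, ← SMod.pp_one, pp_tm, pp_vb, pp_vd, map_smul,
      LinearMap.smul_apply, smul_smul, sg_sq, sg_zero, one_smul]
  · simp only [cupMap_apply, map_sum, act_tm, zero_mul, sg_zero, one_smul, map_add,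
      Finset.sum_add_distrib, act_natV, pp_vb, pp_vd, LinearMap.smul_apply, map_smul, smul_smul,
      sg_sq, act_vd, natAct_vb, LinearMap.sum_apply, map_neg, LinearMap.neg_apply,
      Finset.sum_neg_distrib, sg_conj]
    rw [Finset.sum_comm]
    abel

theorem isHom_cap (N : SMod s n) : IsHom 0 (capMap N) := by
  have key : ∀ y : (tens (dual (natV s n)) (tens (natV s n) N)).carrier,
      N.par (capMap N y) = sg k 0 • capMap N ((tens _ (tens _ N)).par y) ∧
      ∀ δ (x : q s n δ), capMap N ((tens _ (tens _ N)).act δ x y)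
        = sg k (0 * δ) • N.act δ x (capMap N y) := by
    intro y
    induction y using tens_induction with
    | h0 => simp
    | ha x y hx hy =>
      refine ⟨?_, fun δ z => ?_⟩
      · simp only [map_add, hx.1, hy.1, smul_add]
      · simp only [map_add, hx.2, hy.2, smul_add]
    | ht f y =>
      induction y using tens_induction with
      | h0 => simp
      | ha x y hx hy =>
        refine ⟨?_, fun δ z => ?_⟩
        · simp only [map_add, hx.1, hy.1, smul_add]
        · simp only [map_add, hx.2, hy.2, smul_add]
      | ht v m =>
        have hpp : ∀ δ, pair (natV s n) ((dual (natV s n)).pp δ f) ((natV s n).pp δ v)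
            = pair (natV s n) f v := by
          intro δ
          rw [pair_pp, SMod.pp_pp, zadd_self]
          rfl
        refine ⟨?_, fun δ x => ?_⟩
        · rw [par_tm, par_tm, capMap_tm, capMap_tm, map_smul, sg_zero, one_smul]
          exact congrArg (· • N.par m) (hpp 1).symm
        · rw [act_tm, act_tm, map_add, map_add, map_add, capMap_tm, capMap_tm, capMap_tm,
            capMap_tm, hpp, pair_act, pair_pp, zero_mul, sg_zero, one_smul, map_smul, neg_smul,
            neg_add_cancel_left]
  exact ⟨fun m => (key m).1, fun δ x m => (key m).2 δ x⟩

theorem natAct_grade {ε : ZMod 2} (x : q s n ε) (a b : Idx n) (h : b.2 ≠ a.2 + ε) :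
    x.1 b a = 0 := by
  refine x.2.1 b a fun h' => h ?_
  rw [← h']
  linear_combination (-1 : ZMod 2) * zadd_self a.2

theorem isHom_flip (B N : SMod s n) : IsHom 0 (flipMap B N) := by
  have key : ∀ y : (tens (natV s n) (tens B N)).carrier,
      (tens _ (tens _ N)).par (flipMap B N y) = sg k 0 • flipMap B N ((tens _ (tens _ N)).par y) ∧
      ∀ δ (x : q s n δ), flipMap B N ((tens _ (tens _ N)).act δ x y)
        = sg k (0 * δ) • (tens _ (tens _ N)).act δ x (flipMap B N y) := by
    intro y
    induction y using tens_induction with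
    | h0 => simp
    | ha x y hx hy =>
      refine ⟨?_, fun δ z => ?_⟩
      · simp only [map_add, hx.1, hy.1, smul_add]
      · simp only [map_add, hx.2, hy.2, smul_add]
    | ht v y =>
      induction v using natV_induction with
      | h0 => simp
      | ha x z hx hy =>
        refine ⟨?_, fun δ z => ?_⟩
        · simp only [map_add, LinearMap.add_apply, hx.1, hy.1, smul_add]
        · simp only [map_add, LinearMap.add_apply, hx.2, hy.2, smul_add]
      | hs r v hv =>
        refine ⟨?_, fun δ z => ?_⟩
        · simp only [map_smul, LinearMap.smul_apply, hv.1, smul_comm r]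
        · simp only [map_smul, LinearMap.smul_apply, hv.2, smul_comm r]
      | hb a =>
        induction y using tens_induction with
        | h0 => simp
        | ha x y hx hy =>
          refine ⟨?_, fun δ z => ?_⟩
          · simp only [map_add, hx.1, hy.1, smul_add]
          · simp only [map_add, hx.2, hy.2, smul_add]
        | ht w m =>
          refine ⟨?_, fun δ x => ?_⟩
          · simp only [← SMod.pp_one, pp_tm, flipMap_vb, pp_vb, map_smul, LinearMap.smul_apply,
              B.pp_pp, sg_zero, one_smul, add_comm]
          · have h1 : flipMap B N (tm _ _ (natAct s x.1 (vb s a)) (tm B N w m))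
                = tm _ _ (B.pp (a.2 + δ) w) (tm _ _ (natAct s x.1 (vb s a)) m) := by
              simp only [natAct_vb, map_sum, LinearMap.sum_apply, map_smul, LinearMap.smul_apply,
                flipMap_vb]
              refine Finset.sum_congr rfl fun b _ => ?_
              by_cases hb : b.2 = a.2 + δ
              · rw [hb]
              · rw [natAct_grade x a b hb, zero_smul, zero_smul]
            simp only [act_tm, map_add, act_natV, h1, pp_vb, map_smul, LinearMap.smul_apply,
              flipMap_vb, zero_mul, sg_zero, one_smul, B.pp_act, B.pp_pp, smul_add, smul_smul,
              mul_comm a.2, sg_sq, add_comm a.2, one_mul]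
            abel
  exact ⟨fun m => (key m).1, fun δ x m => (key m).2 δ x⟩

theorem natAct_mul (x y : Matrix (Idx n) (Idx n) k) (v : (natV s n).carrier) :
    natAct s (x * y) v = natAct s x (natAct s y v) := by
  change glAct (x * y) (v : V k n) = glAct x (glAct y (v : V k n))
  rw [glAct, LinearEquiv.coe_coe, Matrix.toLin'_mul]
  rfl

theorem natAct_smul (r : k) (x : Matrix (Idx n) (Idx n) k) (v : (natV s n).carrier) :
    natAct s (r • x) v = r • natAct s x v := by
  change glAct (r • x) (v : V k n) = r • glAct x (v : V k n)
  rw [map_smul]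
  rfl

theorem natAct_c (ε : ZMod 2) (x : q s n ε) (v : (natV s n).carrier) :
    natAct s (cMat s) (natAct s x.1 v) = sg k ε • natAct s x.1 (natAct s (cMat s) v) := by
  have h := sub_eq_zero.mp x.2.2
  rw [mul_one] at h
  rw [← natAct_mul, ← natAct_mul, h, natAct_smul, smul_smul, sg_sq, one_smul]

theorem pp_c (ε : ZMod 2) (v : (natV s n).carrier) :
    (natV s n).pp ε (natAct s (cMat s) v) = sg k ε • natAct s (cMat s) ((natV s n).pp ε v) := by
  induction v using natV_induction with
  | h0 => simp
  | hb a =>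
    simp only [cMat_vb, pp_vb, map_smul, smul_smul, mul_add, sg_add, mul_one]
    congr 1
    ring
  | hs r v hv => simp only [map_smul, hv, smul_comm r]
  | ha x y hx hy => simp only [map_add, hx, hy, smul_add]

theorem isHom_c (N : SMod s n) : IsHom 1 (cMap N) := by
  refine isHom_of_tm (fun a m => ?_) (fun δ x a m => ?_)
  · simp only [cMap, tensMap_tm, par_tm, LinearMap.id_apply]
    rw [← SMod.pp_one, pp_c, map_smul, LinearMap.smul_apply, SMod.pp_one]
  · simp only [act_tm, cMap, map_add, tensMap_tm, LinearMap.id_apply, act_natV, natAct_c,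
      map_smul, LinearMap.smul_apply, smul_add, one_mul, pp_c, smul_smul, sg_sq, one_smul]

end Verification

section Verification

open Letter

variable {k : Type u} [Field k] {s : k} {n : ℕ}

theorem dual_induction {P : (dual (natV s n)).carrier → Prop} (h0 : P 0) (hb : ∀ a, P (vd s a))
    (hs : ∀ (r : k) v, P v → P (r • v)) (ha : ∀ x y, P x → P y → P (x + y))
    (f : (dual (natV s n)).carrier) : P f := by
  have h : pair (natV s n) f
      = pair (natV s n) (∑ a : Idx n, pair (natV s n) f (vb s a) • vd s a) := by
    refine natV_ext' fun b => ?_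
    rw [map_sum, LinearMap.sum_apply, Finset.sum_eq_single b]
    · simp [pair_vd_vb]
    · intro a _ h
      simp [pair_vd_vb, h]
    · simp
  have h' : f = ∑ a : Idx n, pair (natV s n) f (vb s a) • vd s a := h
  rw [h']
  exact Finset.sum_induction _ _ ha h0 fun a _ => hs _ _ (hb a)

theorem dual_ext {M : SMod s n} {P : Type u} [AddCommGroup P] [Module k P]
    {f g : (tens (dual (natV s n)) M).carrier →ₗ[k] P}
    (h : ∀ a m, f (tm (dual (natV s n)) M (vd s a) m) = g (tm (dual (natV s n)) M (vd s a) m)) :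
    f = g := by
  refine tens_ext fun v m => ?_
  induction v using dual_induction with
  | h0 => simp
  | hb a => exact h a m
  | hs r v hv => simp [hv]
  | ha v w hv hw => simp [hv, hw]

theorem tens_natV_ext' {A M : SMod s n} {P : Type u} [AddCommGroup P] [Module k P] (v : A.carrier)
    {f g : (tens A (tens (natV s n) M)).carrier →ₗ[k] P}
    (h : ∀ a m, f (tm A _ v (tm (natV s n) M (vb s a) m))
      = g (tm A _ v (tm (natV s n) M (vb s a) m))) (y : (tens (natV s n) M).carrier) :
    f (tm A _ v y) = g (tm A _ v y) := by
  have : f ∘ₗ tm A (tens (natV s n) M) v = g ∘ₗ tm A (tens (natV s n) M) v :=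
    natV_ext fun a m => h a m
  exact LinearMap.congr_fun this y

theorem tens_dual_ext' {A M : SMod s n} {P : Type u} [AddCommGroup P] [Module k P] (v : A.carrier)
    {f g : (tens A (tens (dual (natV s n)) M)).carrier →ₗ[k] P}
    (h : ∀ a m, f (tm A _ v (tm (dual (natV s n)) M (vd s a) m))
      = g (tm A _ v (tm (dual (natV s n)) M (vd s a) m)))
    (y : (tens (dual (natV s n)) M).carrier) : f (tm A _ v y) = g (tm A _ v y) := by
  have : f ∘ₗ tm A (tens (dual (natV s n)) M) v = g ∘ₗ tm A (tens (dual (natV s n)) M) v :=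
    dual_ext fun a m => h a m
  exact LinearMap.congr_fun this y

theorem sum_z {P : Type u} [AddCommMonoid P] (f : ZMod 2 → P) : ∑ ε, f ε = f 0 + f 1 :=
  Fin.sum_univ_two f

/-- The action of `e_{i,j}^ε`. -/
def actE (N : SMod s n) (ε : ZMod 2) (i j : Fin n) : N.carrier →ₗ[k] N.carrier :=
  N.act ε (e s ε i j)

theorem eMat_mul (ε δ : ZMod 2) (i j p r : Fin n) :
    (eMat ε i j * eMat δ p r : Matrix (Idx n) (Idx n) k)
      = if j = p then eMat (ε + δ) i r else 0 := by
  ext a b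
  rw [Matrix.mul_apply, Finset.sum_eq_single (p, b.2 + δ)]
  · simp only [eMat_apply, true_and]
    by_cases hj : j = p
    · subst hj
      simp only [and_true, if_true, eMat_apply]
      by_cases hb : b.1 = r
      · simp [hb, add_assoc, add_comm δ]
      · simp [hb]
    · have hj' : ¬ p = j := fun h => hj h.symm
      simp [hj, hj']
  · intro d _ hd
    simp [eMat_apply, hd]
  · simp

theorem br_e (ε δ : ZMod 2) (i j p r : Fin n) :
    br (e s ε i j) (e s δ p r) = (if j = p then e s (ε + δ) i r else 0)
      - sg k (ε * δ) • (if r = i then e s (ε + δ) p j else 0) := by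
  apply Subtype.ext
  change sbr ε δ (eMat ε i j) (eMat δ p r) = _
  rw [sbr, eMat_mul, eMat_mul, add_comm δ ε]
  by_cases h1 : j = p <;> by_cases h2 : r = i <;> simp [h1, h2, e]

theorem actE_comm (N : SMod s n) (ε δ : ZMod 2) (i j p r : Fin n) (m : N.carrier) :
    actE N δ p r (actE N ε i j m) = sg k (ε * δ) • actE N ε i j (actE N δ p r m)
      - (if j = p then sg k (ε * δ) • actE N (ε + δ) i r m else 0)
      + (if r = i then actE N (ε + δ) p j m else 0) := by
  have h := N.act_br ε δ (e s ε i j) (e s δ p r) m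
  rw [br_e] at h
  have h' : sg k (ε * δ) • actE N δ p r (actE N ε i j m) = actE N ε i j (actE N δ p r m)
      - (if j = p then actE N (ε + δ) i r m else 0)
      + sg k (ε * δ) • (if r = i then actE N (ε + δ) p j m else 0) := by
    rw [eq_sub_iff_add_eq] at h
    rw [sub_add, eq_sub_iff_add_eq]
    refine Eq.trans ?_ h
    rw [add_comm]
    congr 1
    by_cases h1 : j = p <;> by_cases h2 : r = i <;> simp [h1, h2, actE]
  have h'' := congrArg (fun y => sg k (ε * δ) • y) h'
  simp only [smul_smul, sg_sq, one_smul, smul_add, smul_sub] at h''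
  rw [h'']
  simp

theorem q_span (hs : s ≠ 0) {δ : ZMod 2} (x : q s n δ) :
    x = ∑ i, ∑ j, x.1 (i, δ) (j, 0) • e s δ i j := by
  apply Subtype.ext
  have h := sub_eq_zero.mp x.2.2
  have hc : ∀ i j : Fin n, x.1 (i, 1 + δ) (j, 1) = x.1 (i, δ) (j, 0) := by
    intro i j
    have h1 := congrFun (congrFun h (i, 1 + δ)) (j, 0)
    rw [Matrix.smul_apply, Matrix.mul_apply, Matrix.mul_apply, Finset.sum_eq_single (j, 1),
      Finset.sum_eq_single (i, δ)] at h1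
    · simp only [cMat, zero_add, add_comm 1 δ, if_true, sg_zero, one_mul, mul_one,
        smul_eq_mul] at h1
      rw [← mul_assoc, ← mul_assoc, sg_sq, one_mul, mul_comm] at h1
      rw [add_comm 1 δ]
      exact mul_left_cancel₀ hs h1
    · rintro ⟨d1, d2⟩ _ hd
      rw [cMat, if_neg, zero_mul]
      rintro h'
      apply hd
      rw [Prod.ext_iff] at h' ⊢
      refine ⟨h'.1.symm, ?_⟩
      have := h'.2
      simp only at this ⊢
      rw [add_comm 1 δ] at this
      exact (add_right_cancel this).symm
    · simp
    · rintro ⟨d1, d2⟩ _ hd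
      rw [cMat, if_neg, mul_zero]
      simpa using hd
    · simp
  ext ⟨a1, a2⟩ ⟨b1, b2⟩
  simp only [AddSubmonoidClass.coe_finsetSum, Submodule.coe_smul, Matrix.sum_apply,
    Matrix.smul_apply, e, eMat_apply, smul_eq_mul, Prod.mk.injEq]
  rw [Finset.sum_eq_single a1, Finset.sum_eq_single b1]
  · by_cases h2 : a2 = b2 + δ
    · subst h2
      rcases zcases b2 with rfl | rfl
      · simp
      · simp [hc]
    · rw [natAct_grade x (b1, b2) (a1, a2) h2]
      simp [h2]
  · intro j _ hj
    simp [Ne.symm hj]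
  · simp
  · intro i _ hi
    simp [Ne.symm hi]
  · simp

theorem casimir_vb' (N : SMod s n) (b : Idx n) (m : N.carrier) :
    casimir N (tm (natV s n) N (vb s b) m) = ∑ i : Fin n,
      (sg k b.2 • tm (natV s n) N (vb s (i, b.2)) (actE N 0 b.1 i m)
        + tm (natV s n) N (vb s (i, b.2 + 1)) (actE N 1 b.1 i m)) := by
  rw [casimir_vb, sum_z, Finset.sum_add_distrib]
  simp only [zero_add, mul_one, add_zero, zadd_self, mul_zero, sg_zero, one_smul, actE]

theorem isHom_casimir (hs : s ≠ 0) (N : SMod s n) : IsHom 0 (casimir N) := by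
  have key : ∀ y : (tens (natV s n) N).carrier,
      (tens _ N).par (casimir N y) = casimir N ((tens _ N).par y) ∧
      ∀ δ (p r : Fin n), casimir N (actE (tens _ N) δ p r y)
        = actE (tens _ N) δ p r (casimir N y) := by
    intro y
    induction y using tens_induction with
    | h0 => simp
    | ha x y hx hy =>
      refine ⟨?_, fun δ p r => ?_⟩
      · simp only [map_add, hx.1, hy.1]
      · simp only [map_add, hx.2, hy.2]
    | ht v m =>
      induction v using natV_induction with
      | h0 => simp
      | ha x z hx hy =>
        refine ⟨?_, fun δ p r => ?_⟩
        · simp only [map_add, LinearMap.add_apply, hx.1, hy.1]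
        · simp only [map_add, LinearMap.add_apply, hx.2, hy.2]
      | hs r v hv =>
        refine ⟨?_, fun δ p r => ?_⟩
        · simp only [map_smul, LinearMap.smul_apply, hv.1]
        · simp only [map_smul, LinearMap.smul_apply, hv.2]
      | hb b =>
        refine ⟨?_, fun δ p r => ?_⟩
        · simp only [← SMod.pp_one, pp_tm, pp_vb, casimir_vb, map_sum, map_smul,
            LinearMap.smul_apply, N.pp_act, smul_smul, Finset.smul_sum]
          refine Finset.sum_congr rfl fun ε _ => Finset.sum_congr rfl fun i _ => ?_
          congr 1
          rw [one_mul, one_mul, one_mul, sg_add]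
          linear_combination (sg k (b.2 * (ε + 1)) * sg k b.2) * sg_sq (k := k) ε
        · have hact : ∀ (c : Idx n) (m : N.carrier),
              actE (tens (natV s n) N) δ p r (tm _ N (vb s c) m)
                = (if c.1 = r then tm _ N (vb s (p, c.2 + δ)) m else 0)
                  + sg k (δ * c.2) • tm _ N (vb s c) (actE N δ p r m) := by
            intro c m
            rw [actE, act_tm, act_e_vb, pp_vb, map_smul, LinearMap.smul_apply]
            by_cases h : c.1 = r <;> simp [h, actE]
          obtain ⟨b1, b2⟩ := b
          have hif : casimir N (if b1 = r then tm (natV s n) N (vb s (p, b2 + δ)) m else 0)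
              = ∑ i, if b1 = r then
                (sg k (b2 + δ) • tm (natV s n) N (vb s (i, b2 + δ)) (actE N 0 p i m)
                  + tm (natV s n) N (vb s (i, b2 + δ + 1)) (actE N 1 p i m)) else 0 := by
            by_cases h : b1 = r
            · simp only [h, if_true, casimir_vb']
            · simp [h]
          rw [hact, map_add, map_smul, casimir_vb', hif, casimir_vb', map_sum]
          simp only [map_add, map_smul, hact, actE_comm N _ δ b1, map_sub]
          simp only [apply_ite (tm (natV s n) N _), map_zero, Finset.sum_add_distrib,
            Finset.sum_sub_distrib, smul_add, smul_sub, smul_ite, smul_zero,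
            Finset.sum_ite_eq', Finset.mem_univ, if_true, map_smul]
          by_cases h : b1 = r
          · subst h
            rcases zcases δ with rfl | rfl <;> rcases zcases b2 with rfl | rfl
            all_goals simp only [if_true, zero_add, add_zero, zadd_self, sg_zero, sg_one, one_smul,
              mul_zero, mul_one, neg_smul, neg_neg, smul_neg, Finset.sum_add_distrib,
              Finset.sum_neg_distrib]
            all_goals abel
          · have h' : ¬ r = b1 := fun h' => h h'.symm
            rcases zcases δ with rfl | rfl <;> rcases zcases b2 with rfl | rfl
            all_goals simp only [if_neg h, if_neg h', zero_add, add_zero, zadd_self, sg_zero, sg_one,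
              one_smul, mul_zero, mul_one, neg_smul, neg_neg, smul_neg, Finset.sum_neg_distrib,
              Finset.sum_const_zero]
            all_goals abel
  refine ⟨fun m => ?_, fun δ x m => ?_⟩
  · rw [(key m).1, sg_zero, one_smul]
  · rw [q_span hs x]
    simp only [map_sum, map_smul, LinearMap.sum_apply, LinearMap.smul_apply, zero_mul, sg_zero,
      one_smul]
    exact Finset.sum_congr rfl fun i _ => Finset.sum_congr rfl fun j _ =>
      congrArg _ ((key m).2 δ i j)

end Verification

section Verification

open Letter

variable {k : Type u} [Field k] {s : k} {n : ℕ}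

theorem IsHom.act' {M N : SMod s n} {δ : ZMod 2} {h : M.carrier →ₗ[k] N.carrier}
    (hh : IsHom δ h) (ε : ZMod 2) (x : q s n ε) (m : M.carrier) :
    N.act ε x (h m) = sg k (ε * δ) • h (M.act ε x m) := by
  rw [hh.act, smul_smul, mul_comm δ ε, sg_sq, one_smul]

theorem cup_nat {M N : SMod s n} {δ : ZMod 2} {h : M.carrier →ₗ[k] N.carrier} (m : M.carrier) :
    cupMap N (h m) = tensHom _ δ (tensHom _ δ h) (cupMap M m) := by
  simp only [cupMap_apply, map_sum, tensHom_tm, pp_vb, pp_vd, map_smul, LinearMap.smul_apply,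
    smul_smul, sg_sq, one_smul]

theorem cap_nat {M N : SMod s n} {δ : ZMod 2} {h : M.carrier →ₗ[k] N.carrier} :
    capMap N ∘ₗ tensHom _ δ (tensHom _ δ h) = h ∘ₗ capMap M := by
  refine dual_ext fun a y => tens_natV_ext' _ (fun b m => ?_) y
  simp only [LinearMap.comp_apply, tensHom_tm, pp_vb, pp_vd, map_smul, LinearMap.smul_apply,
    capMap_tm, smul_smul, pair_vd_vb]
  by_cases hab : a = b
  · subst hab
    simp [sg_sq]
  · simp [hab]

theorem flip_nat {B M N : SMod s n} {δ : ZMod 2} {h : M.carrier →ₗ[k] N.carrier} :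
    flipMap B N ∘ₗ tensHom _ δ (tensHom _ δ h)
      = tensHom _ δ (tensHom _ δ h) ∘ₗ flipMap B M := by
  refine natV_ext fun a y => ?_
  induction y using tens_induction with
  | h0 => simp
  | ha x y hx hy => simp only [map_add, hx, hy]
  | ht w m =>
    simp only [LinearMap.comp_apply, tensHom_tm, flipMap_vb, pp_vb, map_smul,
      LinearMap.smul_apply, B.pp_pp, add_comm]

theorem casimir_nat {M N : SMod s n} {δ : ZMod 2} {h : M.carrier →ₗ[k] N.carrier}
    (hh : IsHom δ h) : casimir N ∘ₗ tensHom _ δ h = tensHom _ δ h ∘ₗ casimir M := by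
  refine natV_ext fun b m => ?_
  simp only [LinearMap.comp_apply, tensHom_tm, casimir_vb, pp_vb, map_smul,
    LinearMap.smul_apply, map_sum, Finset.smul_sum, hh.act', smul_smul]
  refine Finset.sum_congr rfl fun ε _ => Finset.sum_congr rfl fun i _ => ?_
  congr 1
  rw [mul_add δ, sg_add, mul_comm δ ε]
  ring

theorem c_nat {M N : SMod s n} {δ : ZMod 2} {h : M.carrier →ₗ[k] N.carrier} :
    cMap N ∘ₗ tensHom _ δ h = sg k δ • (tensHom _ δ h ∘ₗ cMap M) := by
  refine natV_ext fun b m => ?_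
  simp only [LinearMap.comp_apply, LinearMap.smul_apply, tensHom_tm, cMap_vb, pp_vb, map_smul,
    smul_smul, mul_add, sg_add, mul_one]
  congr 1
  linear_combination (-(sg k (δ * b.2) * (sg k b.2 * s))) * sg_sq (k := k) δ

theorem genMap_isHom (hs : s ≠ 0) (r : List Letter) (M : SMod s n) {a b : List Letter}
    {ε : ZMod 2} (g : Gen a b ε) : IsHom ε (genMap r M g) := by
  cases g with
  | cup => exact isHom_cup _
  | cap => exact isHom_cap _
  | swap => exact isHom_flip _ _
  | rswap => exact isHom_flip _ _
  | dot => exact isHom_casimir hs _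
  | cdot => exact isHom_c _

theorem Mor.eval_isHom (hs : s ≠ 0) (M : SMod s n) {a b : List Letter} {ε : ZMod 2}
    (f : Mor k a b ε) : IsHom ε (f.eval M) := by
  induction f with
  | id a => exact isHom_id _
  | gen g r => exact genMap_isHom hs r M g
  | lwh l f hf => exact isHom_tensHom _ hf
  | comp h f g hf hg => exact isHom_comp h hf hg
  | zero => exact isHom_zero _ _ _
  | add f g hf hg => exact isHom_add hf hg
  | smul r f hf => exact isHom_smul r hf

theorem isHom_objMap {M N : SMod s n} {δ : ZMod 2} {h : M.carrier →ₗ[k] N.carrier}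
    (hh : IsHom δ h) : ∀ a : List Letter, IsHom δ (objMap δ h a)
  | [] => hh
  | _ :: a => isHom_tensHom _ (isHom_objMap hh a)

theorem genMap_nat (r : List Letter) {M N : SMod s n} {δ : ZMod 2}
    {h : M.carrier →ₗ[k] N.carrier} (hh : IsHom δ h) {a b : List Letter} {ε : ZMod 2}
    (g : Gen a b ε) : genMap r N g ∘ₗ objMap δ h (a ++ r)
      = sg k (ε * δ) • (objMap δ h (b ++ r) ∘ₗ genMap r M g) := by
  cases g with
  | cup =>
    rw [zero_mul, sg_zero, one_smul]
    exact LinearMap.ext fun m => cup_nat m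
  | cap =>
    rw [zero_mul, sg_zero, one_smul]
    exact cap_nat
  | swap =>
    rw [zero_mul, sg_zero, one_smul]
    exact flip_nat
  | rswap =>
    rw [zero_mul, sg_zero, one_smul]
    exact flip_nat
  | dot =>
    rw [zero_mul, sg_zero, one_smul]
    exact casimir_nat (isHom_objMap hh r)
  | cdot =>
    rw [one_mul]
    exact c_nat

theorem tensHom_comp (A : SMod s n) {M N P : SMod s n} {ε δ η : ZMod 2} (h : ε + δ = η)
    (f : N.carrier →ₗ[k] P.carrier) (g : M.carrier →ₗ[k] N.carrier) :
    tensHom A η (f ∘ₗ g) = tensHom A ε f ∘ₗ tensHom A δ g := by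
  subst h
  refine tens_ext fun a m => ?_
  simp only [LinearMap.comp_apply, tensHom_tm, A.pp_pp]

theorem tensHom_add (A : SMod s n) {M N : SMod s n} (ε : ZMod 2)
    (f g : M.carrier →ₗ[k] N.carrier) :
    tensHom A ε (f + g) = tensHom A ε f + tensHom A ε g := by
  refine tens_ext fun a m => ?_
  simp only [LinearMap.add_apply, tensHom_tm, map_add]

theorem tensHom_smul (A : SMod s n) {M N : SMod s n} (ε : ZMod 2) (r : k)
    (f : M.carrier →ₗ[k] N.carrier) :
    tensHom A ε (r • f) = r • tensHom A ε f := by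
  refine tens_ext fun a m => ?_
  simp only [LinearMap.smul_apply, tensHom_tm, map_smul]

theorem tensHom_swap (A : SMod s n) {M N P Q : SMod s n} {ε δ : ZMod 2}
    {f : N.carrier →ₗ[k] P.carrier} {g : M.carrier →ₗ[k] N.carrier}
    {f' : Q.carrier →ₗ[k] P.carrier} {g' : M.carrier →ₗ[k] Q.carrier}
    (h : f ∘ₗ g = sg k (ε * δ) • (f' ∘ₗ g')) :
    tensHom A ε f ∘ₗ tensHom A δ g = sg k (ε * δ) • (tensHom A δ f' ∘ₗ tensHom A ε g') := by
  rw [← tensHom_comp A rfl, ← tensHom_comp A (add_comm δ ε), h]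
  refine tens_ext fun a m => ?_
  simp only [LinearMap.smul_apply, tensHom_tm, map_smul]

/-- The value of `Ψ` on an expression is a supernatural transformation. -/
theorem Mor.eval_nat {M N : SMod s n} {δ : ZMod 2} {h : M.carrier →ₗ[k] N.carrier}
    (hh : IsHom δ h) {a b : List Letter} {ε : ZMod 2} (f : Mor k a b ε) :
    f.eval N ∘ₗ objMap δ h a = sg k (ε * δ) • (objMap δ h b ∘ₗ f.eval M) := by
  induction f with
  | id a =>
    rw [zero_mul, sg_zero, one_smul]
    rfl
  | gen g r => exact genMap_nat r hh g
  | lwh l f hf => exact tensHom_swap _ hf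
  | comp e f g hf hg =>
    subst e
    simp only [Mor.eval]
    rw [LinearMap.comp_assoc, hg, LinearMap.comp_smul, ← LinearMap.comp_assoc, hf,
      LinearMap.smul_comp, smul_smul, add_mul, sg_add, mul_comm, LinearMap.comp_assoc]
  | zero => simp [Mor.eval]
  | add f g hf hg => simp only [Mor.eval, LinearMap.add_comp, LinearMap.comp_add, hf, hg, smul_add]
  | smul r f hf =>
    simp only [Mor.eval, LinearMap.smul_comp, LinearMap.comp_smul, hf, smul_comm r]

theorem interchange_eval (M : SMod s n) {x y a b : List Letter} {ε δ : ZMod 2} (g : Gen x y ε)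
    (f : Mor k a b δ) (hf : IsHom δ (f.eval M)) :
    genMap b M g ∘ₗ (Mor.lwhs f x).eval M
      = sg k (ε * δ) • ((Mor.lwhs f y).eval M ∘ₗ genMap a M g) := by
  cases g with
  | cup =>
    rw [zero_mul, sg_zero, one_smul]
    exact LinearMap.ext fun m => cup_nat m
  | cap =>
    rw [zero_mul, sg_zero, one_smul]
    exact cap_nat
  | swap =>
    rw [zero_mul, sg_zero, one_smul]
    exact flip_nat
  | rswap =>
    rw [zero_mul, sg_zero, one_smul]
    exact flip_nat
  | dot =>
    rw [zero_mul, sg_zero, one_smul]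
    exact casimir_nat hf
  | cdot =>
    rw [one_mul]
    exact c_nat

theorem flip_flip (N : SMod s n) :
    flipMap (natV s n) N ∘ₗ flipMap (natV s n) N = LinearMap.id := by
  refine natV_ext fun a y => tens_natV_ext' _ (fun b m => ?_) y
  simp only [LinearMap.comp_apply, flipMap_vb, pp_vb, map_smul, LinearMap.smul_apply, smul_smul,
    mul_comm a.2, sg_sq, one_smul, LinearMap.id_apply]

theorem flip_braid (N : SMod s n) :
    flipMap (natV s n) (tens (natV s n) N) ∘ₗ (tensHom (natV s n) 0 (flipMap (natV s n) N) ∘ₗ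
        flipMap (natV s n) (tens (natV s n) N))
      = tensHom (natV s n) 0 (flipMap (natV s n) N) ∘ₗ
        (flipMap (natV s n) (tens (natV s n) N) ∘ₗ
          tensHom (natV s n) 0 (flipMap (natV s n) N)) := by
  refine natV_ext fun a y => ?_
  induction y using tens_induction with
  | h0 => simp
  | ha x y hx hy => simp only [map_add, hx, hy]
  | ht v y =>
    induction v using natV_induction with
    | h0 => simp
    | ha x y hx hy => simp only [map_add, LinearMap.add_apply, hx, hy]
    | hs r v hv => simp only [map_smul, LinearMap.smul_apply, hv]
    | hb b =>
      induction y using tens_induction with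
      | h0 => simp
      | ha x y hx hy => simp only [map_add, hx, hy]
      | ht v m =>
        induction v using natV_induction with
        | h0 => simp
        | ha x y hx hy => simp only [map_add, LinearMap.add_apply, hx, hy]
        | hs r v hv => simp only [map_smul, LinearMap.smul_apply, hv]
        | hb c =>
          simp only [LinearMap.comp_apply, flipMap_vb, tensHom_tm, pp_vb, map_smul,
            LinearMap.smul_apply, smul_smul, zero_mul, sg_zero, one_smul]
          congr 1
          ring

theorem zigzag_up_eval (N : SMod s n) :
    tensHom (natV s n) 0 (capMap N) ∘ₗ cupMap (tens (natV s n) N) = LinearMap.id := by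
  refine natV_ext fun b m => ?_
  simp only [LinearMap.comp_apply, cupMap_apply, map_sum, tensHom_tm, capMap_tm, pair_vd_vb,
    pp_vb, zero_mul, sg_zero, one_smul, LinearMap.id_apply]
  rw [Finset.sum_eq_single b]
  · simp
  · intro a _ h
    simp [h]
  · simp

theorem zigzag_down_eval (N : SMod s n) :
    capMap (tens (dual (natV s n)) N) ∘ₗ tensHom (dual (natV s n)) 0 (cupMap N)
      = LinearMap.id := by
  refine dual_ext fun b m => ?_
  simp only [LinearMap.comp_apply, cupMap_apply, map_sum, tensHom_tm, capMap_tm, pair_vd_vb,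
    pp_vd, zero_mul, sg_zero, one_smul, LinearMap.id_apply]
  rw [Finset.sum_eq_single b]
  · simp
  · intro a _ h
    simp [Ne.symm h]
  · simp

/-- The value of `Ψ` on the rotated crossing `↓↑ → ↑↓`. -/
def lswapMap (N : SMod s n) : (tens (dual (natV s n)) (tens (natV s n) N)).carrier →ₗ[k]
    (tens (natV s n) (tens (dual (natV s n)) N)).carrier :=
  capMap (tens (natV s n) (tens (dual (natV s n)) N)) ∘ₗ
    (tensHom (dual (natV s n)) 0 (flipMap (natV s n) (tens (dual (natV s n)) N)) ∘ₗ
      tensHom (dual (natV s n)) 0 (tensHom (natV s n) 0 (cupMap N)))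

theorem lswapMap_apply (N : SMod s n) (a b : Idx n) (m : N.carrier) :
    lswapMap N (tm _ _ (vd s a) (tm _ N (vb s b) m))
      = sg k (a.2 * b.2) • tm _ _ (vb s b) (tm _ N (vd s a) m) := by
  simp only [lswapMap, LinearMap.comp_apply, tensHom_tm, cupMap_apply, map_sum, flipMap_vb,
    capMap_tm, pp_vb, pp_vd, zero_mul, sg_zero, one_smul, map_smul, LinearMap.smul_apply,
    pair_vd_vb]
  rw [Finset.sum_eq_single a]
  · simp [mul_comm]
  · intro d _ h
    simp [Ne.symm h]
  · simp

theorem flip_lswap (N : SMod s n) :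
    flipMap (dual (natV s n)) N ∘ₗ lswapMap N = LinearMap.id := by
  refine dual_ext fun a y => tens_natV_ext' _ (fun b m => ?_) y
  simp only [LinearMap.comp_apply, lswapMap_apply, flipMap_vb, pp_vd, map_smul,
    LinearMap.smul_apply, smul_smul, mul_comm a.2, sg_sq, one_smul, LinearMap.id_apply]

theorem lswap_flip (N : SMod s n) :
    lswapMap N ∘ₗ flipMap (dual (natV s n)) N = LinearMap.id := by
  refine natV_ext fun a y => tens_dual_ext' _ (fun b m => ?_) y
  simp only [LinearMap.comp_apply, lswapMap_apply, flipMap_vb, pp_vd, map_smul,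
    LinearMap.smul_apply, smul_smul, mul_comm a.2, sg_sq, one_smul, LinearMap.id_apply]

theorem c_c (hs : s * s = -1) (N : SMod s n) : cMap N ∘ₗ cMap N = LinearMap.id := by
  refine natV_ext fun b m => ?_
  simp only [LinearMap.comp_apply, cMap_vb, map_smul, smul_smul, sg_add, add_assoc, zadd_self,
    add_zero, sg_one, LinearMap.id_apply]
  have : sg k b.2 * s * (sg k b.2 * -1 * s) = 1 := by
    linear_combination (-(s * s)) * sg_sq (k := k) b.2 - hs
  rw [this, one_smul]

theorem flip_c (N : SMod s n) : flipMap (natV s n) N ∘ₗ cMap (tens (natV s n) N)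
    = tensHom (natV s n) 1 (cMap N) ∘ₗ flipMap (natV s n) N := by
  refine natV_ext fun a y => tens_natV_ext' _ (fun b m => ?_) y
  simp only [LinearMap.comp_apply, cMap_vb, flipMap_vb, pp_vb, map_smul, LinearMap.smul_apply,
    smul_smul, tensHom_tm, add_mul, one_mul, sg_add]
  congr 1
  ring

theorem c_bubble (N : SMod s n) :
    capMap N ∘ₗ (tensHom (dual (natV s n)) 1 (cMap N) ∘ₗ
      (flipMap (dual (natV s n)) N ∘ₗ cupMap N)) = 0 := by
  ext m
  simp only [LinearMap.comp_apply, cupMap_apply, map_sum, flipMap_vb, tensHom_tm, pp_vd,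
    map_smul, LinearMap.smul_apply, cMap_vb, capMap_tm, pair_vd_vb, LinearMap.zero_apply]
  refine Finset.sum_eq_zero fun a _ => ?_
  rw [if_neg]
  · simp
  · intro h
    have h1 := congrArg Prod.snd h
    simp at h1

theorem casimir_c (N : SMod s n) :
    casimir N ∘ₗ cMap N = (-1 : k) • (cMap N ∘ₗ casimir N) := by
  refine natV_ext fun b m => ?_
  simp only [LinearMap.comp_apply, LinearMap.smul_apply, cMap_vb, map_smul, casimir_vb, map_sum,
    Finset.smul_sum, smul_smul]
  refine Finset.sum_congr rfl fun ε _ => Finset.sum_congr rfl fun i _ => ?_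
  have h1 : b.2 + 1 + ε = b.2 + ε + 1 := by ring
  rw [h1]
  congr 1
  simp only [add_mul, one_mul, sg_add, sg_one]
  ring

theorem casimir_flip (hs : s * s = -1) (N : SMod s n) :
    casimir (tens (natV s n) N) ∘ₗ flipMap (natV s n) N
        + (-1 : k) • (flipMap (natV s n) N ∘ₗ tensHom (natV s n) 0 (casimir N))
      = LinearMap.id
        + (-1 : k) • (cMap (tens (natV s n) N) ∘ₗ tensHom (natV s n) 1 (cMap N)) := by
  refine natV_ext fun a y => tens_natV_ext' _ (fun b m => ?_) y
  have hact : ∀ (ε : ZMod 2) (i j : Fin n),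
      (tens (natV s n) N).act ε (e s ε i j) (tm _ N (vb s a) m)
        = (if a.1 = j then tm _ N (vb s (i, a.2 + ε)) m else 0)
          + sg k (ε * a.2) • tm _ N (vb s a) (N.act ε (e s ε i j) m) := by
    intro ε i j
    rw [act_tm, act_e_vb, pp_vb, map_smul, LinearMap.smul_apply]
    by_cases h : a.1 = j <;> simp [h]
  obtain ⟨a1, a2⟩ := a
  obtain ⟨b1, b2⟩ := b
  simp only [LinearMap.add_apply, LinearMap.smul_apply, LinearMap.comp_apply, flipMap_vb, pp_vb,
    map_smul, casimir_vb, map_sum, hact, tensHom_tm, cMap_vb, zero_mul, sg_zero, one_smul,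
    map_add, smul_add, Finset.sum_add_distrib, apply_ite (tm (natV s n) _ _), map_zero, smul_ite,
    smul_zero, Finset.sum_ite_eq, Finset.mem_univ, if_true, Finset.smul_sum, smul_smul,
    LinearMap.id_apply, sum_z]
  rcases zcases a2 with rfl | rfl <;> rcases zcases b2 with rfl | rfl <;>
    simp only [zadd_self, sg_zero, sg_one, zero_add, add_zero, one_smul, neg_smul, mul_one,
      one_mul, mul_zero, mul_neg, neg_mul, neg_neg, hs,
      Finset.sum_neg_distrib]
  all_goals abel

theorem eval_rel (hs : s * s = -1) (M : SMod s n) {a b : List Letter} {ε : ZMod 2}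
    {f g : Mor k a b ε} (h : Rel f g) : f.eval M = g.eval M := by
  have hs0 : s ≠ 0 := by
    rintro rfl
    simp at hs
  induction h with
  | refl f => rfl
  | symm _ ih => exact ih.symm
  | trans _ _ ih ih' => exact ih.trans ih'
  | comp h _ _ ih ih' => simp only [Mor.eval, ih, ih']
  | lwh l _ ih => exact congrArg (tensHom (lmod s n l) _) ih
  | add _ _ ih ih' => simp only [Mor.eval, ih, ih']
  | smul r _ ih => simp only [Mor.eval, ih]
  | id_comp f => rfl
  | comp_id f => rfl
  | assoc h₁ h h₂ h' f₁ f₂ f₃ => rfl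
  | add_assoc f g h => exact add_assoc _ _ _
  | add_comm f g => exact add_comm _ _
  | zero_add f => exact zero_add _
  | zero_smul f => exact zero_smul _ _
  | one_smul f => exact one_smul _ _
  | mul_smul r r' f => exact mul_smul _ _ _
  | add_smul r r' f => exact add_smul _ _ _
  | smul_add r f g => exact smul_add _ _ _
  | comp_add h f g g' => exact LinearMap.comp_add _ _ _
  | add_comp h f f' g => exact LinearMap.add_comp _ _ _
  | comp_smul h r f g => exact LinearMap.comp_smul _ _ _
  | smul_comp h r f g => exact LinearMap.smul_comp _ _ _
  | lwh_id l a => exact tens_ext fun a m => rfl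
  | lwh_comp l h f g => exact tensHom_comp _ h _ _
  | lwh_add l f g => exact tensHom_add _ _ _ _
  | lwh_smul l r f => exact tensHom_smul _ _ _ _
  | interchange g f => exact interchange_eval M g f (Mor.eval_isHom hs0 M f)
  | swap_swap r => exact flip_flip (obj r M)
  | braid r => exact flip_braid (obj r M)
  | zigzag_up r => exact zigzag_up_eval (obj r M)
  | zigzag_down r => exact zigzag_down_eval (obj r M)
  | rswap_lswap r => exact flip_lswap (obj r M)
  | lswap_rswap r => exact lswap_flip (obj r M)
  | cdot_cdot r => exact c_c hs (obj r M)
  | swap_cdot r => exact flip_c (obj r M)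
  | cdot_bubble r => exact c_bubble (obj r M)
  | dot_cdot r => exact casimir_c (obj r M)
  | dot_swap r => exact casimir_flip hs (obj r M)

end Verification

section Center

variable {k : Type u} [Field k] {s : k} {n : ℕ}

/-- Supernatural transformations of parity `ε` between the endofunctors `V^a ⊗ -` and `V^b ⊗ -`
of the category of `U(q)`-supermodules. -/
structure SNat (s : k) (n : ℕ) (a b : List Letter) (ε : ZMod 2) where
  /-- The component at a supermodule. -/
  app : ∀ M : SMod.{u} s n, (obj a M).carrier →ₗ[k] (obj b M).carrier
  isHom : ∀ M : SMod.{u} s n, IsHom ε (app M)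
  nat : ∀ {M N : SMod.{u} s n} {δ : ZMod 2} {h : M.carrier →ₗ[k] N.carrier}, IsHom δ h →
    app N ∘ₗ objMap δ h a = sg k (ε * δ) • (objMap δ h b ∘ₗ app M)

/-- The monoidal superfunctor `Ψ : AOBC → End(U(q)-smod)`, on morphisms. -/
def Ψ (hs : s * s = -1) (n : ℕ) {a b : List Letter} {ε : ZMod 2} :
    Hom k a b ε → SNat s n a b ε :=
  Quot.lift
    (fun f =>
      { app := fun M => f.eval M
        isHom := fun M => f.eval_isHom (by rintro rfl; simp at hs) M
        nat := fun hh => f.eval_nat hh })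
    (fun f g h => by
      congr 1
      exact funext fun M => eval_rel hs M h)

/-- The central element `z_m = Ψ(Δ_m)_{U(q)}(1)` of `U(q)`. -/
def z (hs : s * s = -1) (n m : ℕ) : U s n := (Ψ hs n (Δ k m)).app (regular s n) (1 : U s n)

/-- Sergeev's elements `x_{i,j}^ε(m)` of `U(q)`, defined recursively by
`x_{i,j}^0(0) = δ_{i,j}`, `x_{i,j}^1(0) = 0` and
`x_{i,j}^ε(m+1) = ∑_r e_{i,r}^0 x_{r,j}^ε(m) + (-1)^m e_{i,r}^1 x_{r,j}^{ε+1}(m)`. -/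
def sergeevX (s : k) (n : ℕ) : ℕ → ZMod 2 → Fin n → Fin n → U s n
  | 0, ε, i, j => if ε = 0 ∧ i = j then 1 else 0
  | m + 1, ε, i, j => ∑ r : Fin n, (ι 0 (e s 0 i r) * sergeevX s n m ε r j
      + (-1 : k) ^ m • (ι 1 (e s 1 i r) * sergeevX s n m (ε + 1) r j))

/-- Sergeev's central element `S_t = ∑_i x_{i,i}^0(2t-1)`. -/
def sergeev (s : k) (n t : ℕ) : U s n := ∑ i : Fin n, sergeevX s n (2 * t - 1) 0 i i

end Center

end TypeQ

end

/-! The bubble with `m` black dots evaluates to a supertrace. The cup creates the pairs `v_b ⊗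
v_b^*`, the crossing `s'` contributes the sign `(-1)^{|b|}`, the dots act by the `m`-th power of the
Casimir operator on `V ⊗ U(q)`, and the cap keeps the diagonal. If that power sends `v_b ⊗ u` to
`∑_c v_c ⊗ d_m(b,c) u` with `d_m(b,c) ∈ U(q)`, then `z_m = ∑_b (-1)^{|b|} d_m(b,b)`
(`z_eq_sum_dotCoeff`).

The coefficients `d_m(b,c)` are found by a recursion. Peeling off the dot that acts first, the
operator sends `v_b ⊗ u` to a sum of terms `v_{b'} ⊗ e u`, so `d_{m+1}(b,c)` is a sum of products
`d_m(b',c) e`, with the new generator on the right. Sergeev's recursion puts the new generator `e`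
on the left of `x(m)`. The antipode reverses products, hence turns the second recursion into the
first up to signs.

For `b = (i,β)` and `c = (j,γ)` the signs are absorbed by the closed form `d_m(b,c) = (-(-1)^β)^m
(-1)^{β(β+γ)} σ(x^{β+γ}_{i,j}(m))`, which is `dotCoeff`. The factor `(-(-1)^β)^m` collects the minus
sign of `σ` on each generator together with the sign `(-1)^β` of the even part of the Casimir
operator. An odd generator changes `β`, which replaces this factor by `(-1)^m` times itself; this is
exactly the alternating sign in Sergeev's definition. The factor `(-1)^{β(β+γ)}` accounts for the
Koszul sign of `σ` on an odd generator. That this form satisfies the recursion is `dotCoeff_succ`,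
and `dotsMap_vb` identifies it with the actual coefficients.

On the diagonal only `x^0_{i,i}(m)` survives, with scalar `(-1)^β (-(-1)^β)^m`. For odd `m` this is
`-1` for both values of `β`, so the two parities add up to `-2`; for even `m` they would cancel. -/

namespace TypeQ

universe u

variable {k : Type u} [Field k] {s : k} {n : ℕ}

/-! ### Powers of the Casimir operator. -/

/-- The value of `Ψ` on `m` black dots. -/
def dotsMap (M : SMod s n) (m : ℕ) :
    (tens (natV s n) M).carrier →ₗ[k] (tens (natV s n) M).carrier :=
  (Mor.dots k [] m).eval M

theorem dotsMap_zero (M : SMod s n) : dotsMap M 0 = LinearMap.id := rfl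

theorem dotsMap_succ (M : SMod s n) (m : ℕ) :
    dotsMap M (m + 1) = casimir M ∘ₗ dotsMap M m := rfl

/-- Powers of one operator commute with it. This order isolates the dot that acts first, so that its
generator ends up on the right of the coefficient, as in the recursion for `σ(x(m))`. -/
theorem dotsMap_succ' (M : SMod s n) (m : ℕ) :
    dotsMap M (m + 1) = dotsMap M m ∘ₗ casimir M := by
  induction m with
  | zero => rfl
  | succ m ih => rw [dotsMap_succ, ih, ← LinearMap.comp_assoc, ← dotsMap_succ, ih]

/-! ### The antipode on Sergeev's elements. -/

/-- The antipode moves each generator to the right: `σ(e u) = -(-1)^{|e||u|} σ(u) e`. Writing the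
Koszul sign as the parity automorphism allows `antipode_ι_mul` to be used before the homogeneity of
the elements is known. -/
theorem antipode_sergeevX_succ (m : ℕ) (ε : ZMod 2) (i j : Fin n) :
    antipode s n (sergeevX s n (m + 1) ε i j)
      = ∑ r : Fin n, (-(antipode s n (sergeevX s n m ε r j) * ι 0 (e s 0 i r))
        - (-1 : k) ^ m • (parU s n (antipode s n (sergeevX s n m (ε + 1) r j))
          * ι 1 (e s 1 i r))) := by
  rw [sergeevX, map_sum]
  refine Finset.sum_congr rfl fun r _ => ?_
  rw [map_add, map_smul, antipode_ι_mul, antipode_ι_mul, smul_neg, ← sub_eq_add_neg]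
  simp [parUPow]

/-- The image of `x_{i,j}^ε(m)` under the antipode has parity `ε`. -/
theorem parU_antipode_sergeevX (m : ℕ) (ε : ZMod 2) (i j : Fin n) :
    parU s n (antipode s n (sergeevX s n m ε i j))
      = sg k ε • antipode s n (sergeevX s n m ε i j) := by
  induction m generalizing ε i j with
  | zero =>
    rw [sergeevX]
    -- The only nonzero value at `m = 0` is the even element `1`, which occurs for `ε = 0`; zero has
    -- every parity.
    split_ifs with h
    · simp [antipode_one, h.1]
    · simp
  | succ m ih =>
    simp only [antipode_sergeevX_succ, map_sum, Finset.smul_sum]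
    refine Finset.sum_congr rfl fun r _ => ?_
    simp only [map_sub, map_neg, map_smul, map_mul, ih, parU_ι, sg_add, sg_zero, sg_one,
      one_smul, smul_mul_assoc, mul_smul_comm, smul_sub, smul_neg, smul_smul]
    -- What remains is the odd summand: its two factors have parities `ε + 1` and `1`, and the
    -- product of their signs is `sg k ε`.
    congr 2
    ring

/-! ### Matrix coefficients of the dots and their recursion. -/

/-- The matrix coefficient of `Ψ(x)^m` on `V ⊗ U(q)` from `v_b` to `v_c`. -/
def dotCoeff (s : k) (n m : ℕ) (b c : Idx n) : U s n :=
  ((-sg k b.2) ^ m * sg k (b.2 * (b.2 + c.2))) •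
    antipode s n (sergeevX s n m (b.2 + c.2) b.1 c.1)

theorem dotCoeff_zero (b c : Idx n) : dotCoeff s n 0 b c = if b = c then 1 else 0 := by
  obtain ⟨i, β⟩ := b
  obtain ⟨j, γ⟩ := c
  by_cases h : i = j <;> rcases zcases β with rfl | rfl <;> rcases zcases γ with rfl | rfl <;>
    -- The sign `(-1)^{β(β+γ)}` is `1` when `β = γ`, and when `β ≠ γ` it multiplies `x^1(0) = 0`.
    simp [dotCoeff, sergeevX, antipode_one, zadd_self, h]

/-- This is the recursion satisfied by the coefficients of the powers of the Casimir operator: `v_b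
⊗ u` goes to the terms `(-1)^{|b|} v_{(r,|b|)} ⊗ e^0 u` and `v_{(r,|b|+1)} ⊗ e^1 u`. It matches
`antipode_sergeevX_succ` term by term, so only scalars have to be compared. -/
theorem dotCoeff_succ (m : ℕ) (b c : Idx n) :
    dotCoeff s n (m + 1) b c = ∑ r : Fin n,
      (sg k b.2 • (dotCoeff s n m (r, b.2) c * ι 0 (e s 0 b.1 r))
        + dotCoeff s n m (r, b.2 + 1) c * ι 1 (e s 1 b.1 r)) := by
  obtain ⟨i, β⟩ := b
  obtain ⟨j, γ⟩ := c
  simp only [dotCoeff, antipode_sergeevX_succ, Finset.smul_sum]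
  refine Finset.sum_congr rfl fun r _ => ?_
  simp only [parU_antipode_sergeevX, smul_mul_assoc, smul_sub, smul_neg, smul_smul]
  -- The upper index of `x` at the shifted vector `(r, β + 1)` is brought to the form `(β + γ) + 1`
  -- of Sergeev's recursion; the minus signs of the antipode go into the scalars.
  rw [add_right_comm β 1 γ, sub_eq_add_neg, ← neg_smul, ← neg_smul]
  congr 2
  -- Even generator: the extra factor `-(-1)^β` and the minus sign of the antipode give `(-1)^β`.
  · ring
  -- Odd generator: changing `β` to `β + 1` multiplies the `m`-th power by `(-1)^m`, and the
  -- remaining signs agree because `(β+1)(β+γ+1) = β(β+γ) + β + (β+γ+1)` modulo 2.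
  · rcases zcases β with rfl | rfl <;> rcases zcases γ with rfl | rfl <;>
      simp [zadd_self, pow_succ, ← mul_pow]

/-! ### The dots acting on `V ⊗ U(q)`. -/

/-- Left multiplication on the regular supermodule. -/
def mulL (s : k) (n : ℕ) : U s n →ₗ[k] Module.End k (regular s n).carrier :=
  LinearMap.mul k (U s n)

theorem mulL_mul (a b : U s n) (u : (regular s n).carrier) :
    mulL s n (a * b) u = mulL s n a (mulL s n b u) := mul_assoc a b (u : U s n)

theorem mulL_one (u : (regular s n).carrier) : mulL s n 1 u = u :=
  one_mul (M := U s n) u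

theorem actE_regular (ε : ZMod 2) (i j : Fin n) (u : (regular s n).carrier) :
    actE (regular s n) ε i j u = mulL s n (ι ε (e s ε i j)) u := rfl

/-- Both sides obey the same recursion in `m`. The induction needs arbitrary `b` and `u`, since the
first dot changes the basis vector and multiplies `u` by a generator. The total parity is even, but
the coefficients act by plain left multiplication: all signs are already in `dotCoeff`. -/
theorem dotsMap_vb (m : ℕ) (b : Idx n) (u : (regular s n).carrier) :
    dotsMap (regular s n) m (tm (natV s n) (regular s n) (vb s b) u)
      = ∑ c : Idx n, tm (natV s n) (regular s n) (vb s c) (mulL s n (dotCoeff s n m b c) u) := by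
  induction m generalizing b u with
  | zero =>
    rw [dotsMap_zero, LinearMap.id_apply, Finset.sum_eq_single b]
    · rw [dotCoeff_zero, if_pos rfl, mulL_one]
    · intro c _ h
      rw [dotCoeff_zero, if_neg (Ne.symm h), map_zero, LinearMap.zero_apply, map_zero]
    · simp
  | succ m ih =>
    rw [dotsMap_succ', LinearMap.comp_apply, casimir_vb', map_sum]
    simp only [map_add, map_smul, ih, actE_regular, dotCoeff_succ, map_sum, LinearMap.sum_apply,
      LinearMap.add_apply, LinearMap.smul_apply, mulL_mul, Finset.smul_sum,
      ← Finset.sum_add_distrib]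
    -- The Casimir expansion sums over the intermediate index first and the final vector second; the
    -- coefficient recursion has the opposite order.
    exact Finset.sum_comm

/-! ### The bubble as a supertrace. -/

/-- The cap pairs `v_b^*` with the image of `v_b` under the dots and so selects the diagonal
coefficient; the crossing `s'` makes the resulting trace a supertrace. -/
theorem z_eq_sum_dotCoeff (hs : s * s = -1) (m : ℕ) :
    z hs n m = ∑ b : Idx n, sg k b.2 • dotCoeff s n m b b := by
  -- The composite displayed here is the unfolded value of `Ψ` on the bubble; on the regular
  -- supermodule it is left multiplication by the supertrace.
  have key : ∀ u : (regular s n).carrier,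
      capMap (regular s n) (tensHom (dual (natV s n)) 0 (dotsMap (regular s n) m)
        (flipMap (dual (natV s n)) (regular s n) (cupMap (regular s n) u)))
      = mulL s n (∑ b : Idx n, sg k b.2 • dotCoeff s n m b b) u := by
    intro u
    rw [cupMap_apply]
    simp only [map_sum, LinearMap.sum_apply]
    refine Finset.sum_congr rfl fun b _ => ?_
    simp only [flipMap_vb, pp_vd, map_smul, LinearMap.smul_apply, tensHom_tm, zero_mul, sg_zero,
      one_smul, dotsMap_vb, map_sum, capMap_tm, pair_vd_vb, ite_smul, zero_smul,
      Finset.sum_ite_eq, Finset.mem_univ, if_true]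
    -- The sign of the crossing appears as `(-1)^{|b||b|}`, which equals `(-1)^{|b|}`.
    rcases zcases b.2 with h | h <;> simp [h]
  exact (key (1 : U s n)).trans (mul_one (∑ b : Idx n, sg k b.2 • dotCoeff s n m b b))

/-- On the diagonal `|b| + |b| = 0`, so only the even elements `x^0` occur and the second sign of
`dotCoeff` disappears. -/
theorem z_eq_sum_antipode (hs : s * s = -1) (m : ℕ) :
    z hs n m = ∑ b : Idx n, (sg k b.2 * (-sg k b.2) ^ m) •
      antipode s n (sergeevX s n m 0 b.1 b.1) := by
  rw [z_eq_sum_dotCoeff]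
  refine Finset.sum_congr rfl fun b _ => ?_
  rw [dotCoeff, zadd_self, mul_zero, sg_zero, mul_one, smul_smul]

end TypeQ

theorem mainTheorem12 {k : Type*} [Field k] (h2 : (2 : k) ≠ 0) (s : k) (hs : s * s = -1)
    (n t : ℕ) (ht : 1 ≤ t) :
    TypeQ.z hs n (2 * t - 1) = (-2 : k) • TypeQ.antipode s n (TypeQ.sergeev s n t) := by
  -- The truncated subtraction gives `2 * t - 1 = 2 * (t - 1) + 1` because `1 ≤ t`.
  have hodd : Odd (2 * t - 1) := ⟨t - 1, by omega⟩
  rw [TypeQ.z_eq_sum_antipode, TypeQ.sergeev, map_sum, Finset.smul_sum, Fintype.sum_prod_type]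
  refine Finset.sum_congr rfl fun i _ => ?_
  -- For fixed `i`, the even vector contributes `1 * (-1)^(2t-1) = -1` and the odd vector `(-1) *
  -- 1^(2t-1) = -1`, both times the same element.
  rw [TypeQ.sum_z, TypeQ.sg_zero, TypeQ.sg_one, neg_neg, one_pow, hodd.neg_one_pow, ← add_smul]
  norm_num
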